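/- **Setting.** On $\mathbb R^6\cong\mathbb C^3$ put $(z^1,z^2,z^3)=(x^1+ix^4,x^2+ix^5,x^3+ix^6)$. A *nearly-Kähler structure* on an open set $U\subset\mathbb R^6$ is a smooth pair $\Omega\in\Omega^2(U)$, $\Upsilon\in\Omega^3(U;\mathbb C)$ such that at each $y\in U$ there is a linear isomorphism $f:T_yU\to\mathbb R^6$ (an *$\mathrm{SU}(3)$-coframe*) with $\Omega_y=f^*(dx^1\wedge dx^4+dx^2\wedge dx^5+dx^3\wedge dx^6)$ and $\Upsilon_y=f^*(dz^1\wedge dz^2\wedge dz^3)$, and such that $d\Omega=3\,\mathrm{Im}\,\Upsilon$, $d\,\mathrm{Re}\,\Upsilon=2\,\Omega\wedge\Omega$, $d\,\mathrm{Im}\,\Upsilon=0$. Let a connected Lie group $G$ act smoothly and faithfully on $U$, preserving $(\Omega,\Upsilon)$, closed in the isometry group, with all orbits principal, $4$-dimensional and coisotropic (that is, $\Omega\wedge\Omega$ vanishes on them). Let $P\to U$ be the $\mathrm O(2)$-bundle whose fibre over $y$ consists of the $\mathrm{SU}(3)$-coframes $f=(f^1,\dots,f^6)$ at $y$ with $T_y(Gy)=\ker(f^1,f^2)$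 (*$\mathrm O(2)$-coframes*), let $\omega^1,\dots,\omega^6$ be the tautological $1$-forms on $P$, and put $\eta=\omega^1+i\omega^2$, $\theta=\omega^4+i\omega^5$. There are unique functions $p_1,\dots,p_4,q_1,q_2,r:P\to\mathbb C$ and $h_1,\dots,h_4:P\to\mathbb R$ and a unique real $1$-form $\alpha$ on $P$ such that, with $$\begin{aligned}2\xi_1&=h_1\eta-ih_2\theta+q_1\bar\theta+p_1\omega^3+p_2\omega^6,&2\xi_2&=ih_4\eta+(h_3-i)\theta+q_2\bar\theta-ip_2\omega^3+p_3\omega^6,\\ \xi_3&=p_4\theta-ir\bar\theta-iq_1\omega^3+q_2\omega^6,&\xi_0&=\bar p_4\theta+p_4\bar\theta-h_2\omega^3+h_3\omega^6,\end{aligned}$$ one has $$\begin{aligned} d\eta&=i\alpha\wedge\eta-2i\xi_1\wedge\omega^3+\xi_0\wedge\theta+\xi_3\wedge\bar\theta+2\xi_2\wedge\omega^6+i(-\eta\wedge\omega^3+\theta\wedge\omega^6),\\ d\omega^3&=-i\bar\xi_1\wedge\eta+i\xi_1\wedge\bar\eta+\bar\xi_2\wedge\theta+\xi_2\wedge\bar\theta-2\xi_0\wedge\omega^6+\tfrac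 i2(\eta\wedge\bar\eta-\theta\wedge\bar\theta),\\ d\theta&=-\xi_0\wedge\eta-\xi_3\wedge\bar\eta-2\xi_2\wedge\omega^3+i\alpha\wedge\theta-2i\xi_1\wedge\omega^6+i(-\omega^3\wedge\theta+\eta\wedge\omega^6),\\ d\omega^6&=-\bar\xi_2\wedge\eta-\xi_2\wedge\bar\eta+2\xi_0\wedge\omega^3-i\bar\xi_1\wedge\theta+i\xi_1\wedge\bar\theta+\tfrac i2(\bar\theta\wedge\eta-\theta\wedge\bar\eta). \end{aligned}$$ Put $s_1=(h_1+3)+ih_3$ and $s_2=h_2+ih_4$. The structure is of *Type III* if, everywhere on $P$, $\mathrm{Re}(q_1\bar q_2)=\mathrm{Re}(s_2\bar s_1)=0$ and $(q_1,q_2,s_1,s_2)\neq(0,0,0,0)$. When it is of Type III and the Lie algebra $\mathfrak g$ of $G$ is isomorphic to $\mathfrak{su}(2)\oplus\mathfrak u(1)$, there are unique functions $u,v,\hat v,z,w:P\to\mathbb C$ and $t_1:P\to\mathbb R$ with $$q_1=it_1z,\quad q_2=z,\quad s_2=it_1w,\quad s_1=w,\quad p_1+4ip_4=6u,\quad p_2=-6t_1u,\quad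 p_3+4p_4=24v,\quad -p_3+4p_4=24\hat v .$$ Put $(a_1,a_2,a_0)=(24\,\mathrm{Re}\,v,\,24\,\mathrm{Im}\,v,\,3t_1):P\to\mathbb R^3$. **Theorem 6.1.** Nearly-Kähler structures of Type III with $\mathfrak g=\mathfrak{su}(2)\oplus\mathfrak u(1)$ and $u=0$ exist locally. In fact, for every $x\in\mathbb R^6$ and every $(x_0,y_0,z_0)\in\mathbb R^3$ there are a connected open neighbourhood $U\subset\mathbb R^6$ of $x$, a nearly-Kähler structure $(\Omega,\Upsilon)$ on $U$ and a connected Lie group $G$ with $\mathfrak g\cong\mathfrak{su}(2)\oplus\mathfrak u(1)$ acting on $U$ as above, such that the structure is of Type III with $u=0$ on all of $P$, and there is an $\mathrm O(2)$-coframe $f_x\in P|_x$ with $$(a_1,a_2,a_0)(f_x)=(x_0,y_0,z_0).$$ -/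

import Mathlib

open Set Filter Topology Complex
open scoped Manifold ContDiff Matrix

noncomputable section

namespace NK

/-- The space `ℝ⁶`. The coordinates `x¹, …, x⁶` are indexed by `0, …, 5`. -/
abbrev R6 : Type := EuclideanSpace ℝ (Fin 6)

/-! ### `SU(3)`-structures and nearly-Kähler structures on open subsets of `ℝ⁶` -/

/-- A differential 2-form on (an open subset of) `ℝ⁶`. -/
abbrev TwoForm : Type := R6 → R6 [⋀^Fin 2]→L[ℝ] ℝ

/-- A complex-valued differential 3-form on (an open subset of) `ℝ⁶`. -/
abbrev ThreeFormC : Type := R6 → R6 [⋀^Fin 3]→L[ℝ] ℂ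

/-- The standard 2-form `dx¹ ∧ dx⁴ + dx² ∧ dx⁵ + dx³ ∧ dx⁶`, evaluated on `v, w`. -/
def stdOmega (v w : R6) : ℝ :=
  (v 0 * w 3 - v 3 * w 0) + (v 1 * w 4 - v 4 * w 1) + (v 2 * w 5 - v 5 * w 2)

/-- The standard complex coordinates `(z¹, z², z³) = (x¹ + i x⁴, x² + i x⁵, x³ + i x⁶)`. -/
def zCoord (v : R6) : Fin 3 → ℂ :=
  ![(v 0 : ℂ) + I * (v 3 : ℂ), (v 1 : ℂ) + I * (v 4 : ℂ), (v 2 : ℂ) + I * (v 5 : ℂ)]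

/-- The standard complex volume form `dz¹ ∧ dz² ∧ dz³`, evaluated on three vectors. -/
def stdUpsilon (v : Fin 3 → R6) : ℂ :=
  Matrix.det (Matrix.of fun i j => zCoord (v j) i)

/-- `f` is a coframe at `y` (an isomorphism `T_y ℝ⁶ → ℝ⁶`) that takes `(Ω, Υ)` at `y` to the standard
model. -/
def IsSU3Coframe (Ω : TwoForm) (Υ : ThreeFormC) (y : R6) (f : R6 →L[ℝ] R6) : Prop :=
  Function.Bijective f ∧
  (∀ v : Fin 2 → R6, Ω y v = stdOmega (f (v 0)) (f (v 1))) ∧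
  (∀ v : Fin 3 → R6, Υ y v = stdUpsilon (fun i => f (v i)))

/-- The real part of a complex 3-form. -/
def rePart (Υ : ThreeFormC) : R6 → R6 [⋀^Fin 3]→L[ℝ] ℝ :=
  fun y => Complex.reCLM.compContinuousAlternatingMap (Υ y)

/-- The imaginary part of a complex 3-form. -/
def imPart (Υ : ThreeFormC) : R6 → R6 [⋀^Fin 3]→L[ℝ] ℝ :=
  fun y => Complex.imCLM.compContinuousAlternatingMap (Υ y)

/-- The 4-form `Ω ∧ Ω` at `y`, evaluated on four vectors. -/
def omegaSq (Ω : TwoForm) (y : R6) (v : Fin 4 → R6) : ℝ :=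
  2 * (Ω y ![v 0, v 1] * Ω y ![v 2, v 3] - Ω y ![v 0, v 2] * Ω y ![v 1, v 3]
    + Ω y ![v 0, v 3] * Ω y ![v 1, v 2])

/-- `(Ω, Υ)` is a (strict, scaled to `c = 1`) nearly-Kähler structure on the open set `U`: a smooth
`SU(3)`-structure with `dΩ = 3 Im Υ`, `d Re Υ = 2 Ω ∧ Ω` and `d Im Υ = 0`. -/
structure IsNearlyKahlerOn (U : Set R6) (Ω : TwoForm) (Υ : ThreeFormC) : Prop where
  smooth_omega : ContDiffOn ℝ ∞ Ω U
  smooth_upsilon : ContDiffOn ℝ ∞ Υ U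
  su3 : ∀ y ∈ U, ∃ f : R6 →L[ℝ] R6, IsSU3Coframe Ω Υ y f
  d_omega : ∀ y ∈ U, extDeriv Ω y = (3 : ℝ) • imPart Υ y
  d_re : ∀ y ∈ U, ∀ v : Fin 4 → R6, extDeriv (rePart Υ) y v = 2 * omegaSq Ω y v
  d_im : ∀ y ∈ U, extDeriv (imPart Υ) y = 0

/-! ### The acting Lie group -/

section Action

variable {V : Type} [NormedAddCommGroup V] [NormedSpace ℝ V]
  {G : Type} [Group G] [TopologicalSpace G] [ChartedSpace V G]

/-- `act` is a smooth (left) action of the Lie group `G` on the open set `U`. -/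
structure IsSmoothActionOn (act : G → R6 → R6) (U : Set R6) : Prop where
  mapsTo : ∀ g, MapsTo (act g) U U
  one : ∀ y ∈ U, act 1 y = y
  mul : ∀ g h, ∀ y ∈ U, act (g * h) y = act g (act h y)
  smooth : ContMDiffOn (𝓘(ℝ, V).prod 𝓘(ℝ, R6)) 𝓘(ℝ, R6) ∞
    (fun p : G × R6 => act p.1 p.2) (univ ×ˢ U)

/-- The tangent space at `y` of the orbit `G y`: the image of the differential at `1` of the orbit
map `g ↦ g y`. -/
def orbitTangent (act : G → R6 → R6) (y : R6) : Submodule ℝ R6 :=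
  LinearMap.range
    (mfderiv 𝓘(ℝ, V) 𝓘(ℝ, R6) (fun g : G => act g y) 1 : V →L[ℝ] R6).toLinearMap

/-- The Lie group `G` acts on `U` through `act`, with cohomogeneity two and coisotropic orbits,
preserving `(Ω, Υ)`. The action is faithful, `G` is closed in the isometry group, and every orbit in
`U` is principal. -/
structure IsCohomTwoSymmetry (U : Set R6) (Ω : TwoForm) (Υ : ThreeFormC)
    (act : G → R6 → R6) : Prop where
  action : IsSmoothActionOn (V := V) act U
  preserves_omega : ∀ g, ∀ y ∈ U, ∀ v : Fin 2 → R6,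
    Ω (act g y) (fun i => fderiv ℝ (act g) y (v i)) = Ω y v
  preserves_upsilon : ∀ g, ∀ y ∈ U, ∀ v : Fin 3 → R6,
    Υ (act g y) (fun i => fderiv ℝ (act g) y (v i)) = Υ y v
  faithful : ∀ g, (∀ y ∈ U, act g y = y) → g = 1
  /-- The image of `G` is closed among the continuous maps `U → U`, for uniform convergence on
  compact sets; in particular it is closed in the isometry group of `U`. -/
  closed : ∀ (g : ℕ → G) (h : R6 → R6), MapsTo h U U →
    TendstoLocallyUniformlyOn (fun n => act (g n)) h atTop U → ∃ k : G, EqOn (act k) h U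
  /-- All orbits have the same type: the stabilizers are conjugate. -/
  principal : ∀ y ∈ U, ∀ z ∈ U, ∃ k : G, ∀ g : G, act g y = y ↔ act (k * g * k⁻¹) z = z
  cohomogeneity_two : ∀ y ∈ U, Module.finrank ℝ (orbitTangent (V := V) act y) = 4
  coisotropic : ∀ y ∈ U, ∀ v : Fin 4 → R6, (∀ i, v i ∈ orbitTangent (V := V) act y) →
    omegaSq Ω y v = 0

end Action

section LieAlgebras

attribute [local instance] LieRing.ofAssociativeRing

/-- The real Lie algebra `𝔲(n)` of skew-Hermitian matrices, with the commutator bracket. -/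
def u (n : ℕ) : LieSubalgebra ℝ (Matrix (Fin n) (Fin n) ℂ) where
  carrier := {A | Aᴴ = -A}
  zero_mem' := by simp
  add_mem' := by
    intro A B hA hB
    change Aᴴ = -A at hA
    change Bᴴ = -B at hB
    change (A + B)ᴴ = -(A + B)
    rw [Matrix.conjTranspose_add, hA, hB, neg_add]
  smul_mem' := by
    intro c A hA
    change Aᴴ = -A at hA
    change (c • A)ᴴ = -(c • A)
    rw [Matrix.conjTranspose_smul, hA, star_trivial, smul_neg]
  lie_mem' := by
    intro A B hA hB
    change Aᴴ = -A at hA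
    change Bᴴ = -B at hB
    change ⁅A, B⁆ᴴ = -⁅A, B⁆
    rw [LieRing.of_associative_ring_bracket, Matrix.conjTranspose_sub,
      Matrix.conjTranspose_mul, Matrix.conjTranspose_mul, hA, hB]
    simp

/-- The real Lie algebra `𝔰𝔲(n)` of traceless skew-Hermitian matrices, with the commutator
bracket. -/
def su (n : ℕ) : LieSubalgebra ℝ (Matrix (Fin n) (Fin n) ℂ) where
  carrier := {A | Aᴴ = -A ∧ A.trace = 0}
  zero_mem' := by simp
  add_mem' := by
    intro A B hA hB
    exact ⟨(u n).add_mem hA.1 hB.1, by rw [Matrix.trace_add, hA.2, hB.2, add_zero]⟩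
  smul_mem' := by
    intro c A hA
    exact ⟨(u n).smul_mem c hA.1, by rw [Matrix.trace_smul, hA.2, smul_zero]⟩
  lie_mem' := by
    intro A B hA hB
    refine ⟨(u n).lie_mem hA.1 hB.1, ?_⟩
    rw [LieRing.of_associative_ring_bracket, Matrix.trace_sub, Matrix.trace_mul_comm, sub_self]

/-- The Lie algebra of the Lie group `G` is isomorphic to `𝔰𝔲(2) ⊕ 𝔲(1)`. -/
def HasLieAlgebraSU2U1 (V : Type) [NormedAddCommGroup V] [NormedSpace ℝ V]
    (G : Type) [Group G] [TopologicalSpace G] [ChartedSpace V G] : Prop :=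
  ∃ e : GroupLieAlgebra 𝓘(ℝ, V) G ≃ₗ[ℝ] (su 2 × u 1), ∀ X Y, e ⁅X, Y⁆ = ⁅e X, e Y⁆

end LieAlgebras

/-! ### The `O(2)`-bundle `P` and its torsion -/

/-- `f` belongs to the fibre over `y` of the `O(2)`-bundle `P` of adapted coframes: `f` is an
`SU(3)`-coframe, and the kernel of its first two components is the plane `W y` (below, the tangent
space of the orbit through `y`). -/
def IsO2Coframe (Ω : TwoForm) (Υ : ThreeFormC) (W : R6 → Submodule ℝ R6) (y : R6)
    (f : R6 →L[ℝ] R6) : Prop :=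
  IsSU3Coframe Ω Υ y f ∧ ∀ v, v ∈ W y ↔ f v 0 = 0 ∧ f v 1 = 0

/-- The values of the torsion functions at an `O(2)`-coframe. -/
structure Torsion where
  (p₁ p₂ p₃ p₄ q₁ q₂ r : ℂ)
  (h₁ h₂ h₃ h₄ : ℝ)

/-- The wedge product of two complex covectors, evaluated on `v, w`. -/
def wedge (a b : R6 → ℂ) (v w : R6) : ℂ := a v * b w - a w * b v

/-- The complex conjugate of a complex covector. -/
def cbar (a : R6 → ℂ) (v : R6) : ℂ := (starRingEnd ℂ) (a v)

/-- `η = ω¹ + i ω²`. -/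
def eta (f : R6 →L[ℝ] R6) (v : R6) : ℂ := (f v 0 : ℂ) + I * (f v 1 : ℂ)

/-- `θ = ω⁴ + i ω⁵`. -/
def theta (f : R6 →L[ℝ] R6) (v : R6) : ℂ := (f v 3 : ℂ) + I * (f v 4 : ℂ)

/-- `ω³`. -/
def omega3 (f : R6 →L[ℝ] R6) (v : R6) : ℂ := (f v 2 : ℂ)

/-- `ω⁶`. -/
def omega6 (f : R6 →L[ℝ] R6) (v : R6) : ℂ := (f v 5 : ℂ)

namespace Torsion

variable (T : Torsion)

/-- `2 ξ₁ = h₁ η - i h₂ θ + q₁ θ̄ + p₁ ω³ + p₂ ω⁶`. -/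
def xi₁ (f : R6 →L[ℝ] R6) (v : R6) : ℂ :=
  (1 / 2 : ℂ) * ((T.h₁ : ℂ) * eta f v - I * (T.h₂ : ℂ) * theta f v + T.q₁ * cbar (theta f) v
    + T.p₁ * omega3 f v + T.p₂ * omega6 f v)

/-- `2 ξ₂ = i h₄ η + (h₃ - i) θ + q₂ θ̄ - i p₂ ω³ + p₃ ω⁶`. -/
def xi₂ (f : R6 →L[ℝ] R6) (v : R6) : ℂ :=
  (1 / 2 : ℂ) * (I * (T.h₄ : ℂ) * eta f v + ((T.h₃ : ℂ) - I) * theta f v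
    + T.q₂ * cbar (theta f) v - I * T.p₂ * omega3 f v + T.p₃ * omega6 f v)

/-- `ξ₃ = p₄ θ - i r θ̄ - i q₁ ω³ + q₂ ω⁶`. -/
def xi₃ (f : R6 →L[ℝ] R6) (v : R6) : ℂ :=
  T.p₄ * theta f v - I * T.r * cbar (theta f) v - I * T.q₁ * omega3 f v + T.q₂ * omega6 f v

/-- `ξ₀ = p̄₄ θ + p₄ θ̄ - h₂ ω³ + h₃ ω⁶`. -/
def xi₀ (f : R6 →L[ℝ] R6) (v : R6) : ℂ :=
  (starRingEnd ℂ) T.p₄ * theta f v + T.p₄ * cbar (theta f) v - (T.h₂ : ℂ) * omega3 f v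
    + (T.h₃ : ℂ) * omega6 f v

/-- The first structure equations for an `O(2)`-coframe `f` with torsion `T` and connection form
`α`, where `df` is the exterior derivative of the coframing at the point considered. -/
structure StructureEquations (f : R6 →L[ℝ] R6) (df : R6 → R6 → R6) (α : R6 →ₗ[ℝ] ℝ) :
    Prop where
  d_eta : ∀ v w, ((df v w 0 : ℝ) : ℂ) + I * ((df v w 1 : ℝ) : ℂ) =
    I * wedge (fun x => (α x : ℂ)) (eta f) v w
    - 2 * I * wedge (T.xi₁ f) (omega3 f) v w
    + wedge (T.xi₀ f) (theta f) v w
    + wedge (T.xi₃ f) (cbar (theta f)) v w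
    + 2 * wedge (T.xi₂ f) (omega6 f) v w
    + I * (- wedge (eta f) (omega3 f) v w + wedge (theta f) (omega6 f) v w)
  d_omega3 : ∀ v w, ((df v w 2 : ℝ) : ℂ) =
    - I * wedge (cbar (T.xi₁ f)) (eta f) v w
    + I * wedge (T.xi₁ f) (cbar (eta f)) v w
    + wedge (cbar (T.xi₂ f)) (theta f) v w
    + wedge (T.xi₂ f) (cbar (theta f)) v w
    - 2 * wedge (T.xi₀ f) (omega6 f) v w
    + I * (1 / 2) * (wedge (eta f) (cbar (eta f)) v w - wedge (theta f) (cbar (theta f)) v w)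
  d_theta : ∀ v w, ((df v w 3 : ℝ) : ℂ) + I * ((df v w 4 : ℝ) : ℂ) =
    - wedge (T.xi₀ f) (eta f) v w
    - wedge (T.xi₃ f) (cbar (eta f)) v w
    - 2 * wedge (T.xi₂ f) (omega3 f) v w
    + I * wedge (fun x => (α x : ℂ)) (theta f) v w
    - 2 * I * wedge (T.xi₁ f) (omega6 f) v w
    + I * (- wedge (omega3 f) (theta f) v w + wedge (eta f) (omega6 f) v w)
  d_omega6 : ∀ v w, ((df v w 5 : ℝ) : ℂ) =
    - wedge (cbar (T.xi₂ f)) (eta f) v w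
    - wedge (T.xi₂ f) (cbar (eta f)) v w
    + 2 * wedge (T.xi₀ f) (omega3 f) v w
    - I * wedge (cbar (T.xi₁ f)) (theta f) v w
    + I * wedge (T.xi₁ f) (cbar (theta f)) v w
    + I * (1 / 2) * (wedge (cbar (theta f)) (eta f) v w - wedge (theta f) (cbar (eta f)) v w)

/-- `T` is the value of the torsion functions of the `O(2)`-structure `P` at the coframe `f ∈ P_y`:
for a local smooth section `σ` of `P` through `f`, the pull-back by `σ` of the structure equations
on `P` holds at `y`, `α` being the pull-back of the connection form. The equations determine `T`
and do not depend on the choice of `σ`. -/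
def IsAt (Ω : TwoForm) (Υ : ThreeFormC) (W : R6 → Submodule ℝ R6) (y : R6)
    (f : R6 →L[ℝ] R6) : Prop :=
  ∃ σ : R6 → R6 →L[ℝ] R6,
    ContDiffAt ℝ ∞ σ y ∧ (∀ᶠ z in 𝓝 y, IsO2Coframe Ω Υ W z (σ z)) ∧ σ y = f ∧
    ∃ α : R6 →ₗ[ℝ] ℝ,
      T.StructureEquations f (fun v w => fderiv ℝ σ y v w - fderiv ℝ σ y w v) α

/-- `s₁ = (h₁ + 3) + i h₃`. -/
def s₁ : ℂ := ((T.h₁ : ℂ) + 3) + I * (T.h₃ : ℂ)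

/-- `s₂ = h₂ + i h₄`. -/
def s₂ : ℂ := (T.h₂ : ℂ) + I * (T.h₄ : ℂ)

/-- Type III: `⟨q₁, q₂⟩ = ⟨s₂, s₁⟩ = 0` and `(q₁, q₂, s₁, s₂) ≠ (0, 0, 0, 0)`. -/
def IsTypeIII : Prop :=
  (T.q₁ * (starRingEnd ℂ) T.q₂).re = 0 ∧ (T.s₂ * (starRingEnd ℂ) T.s₁).re = 0 ∧
    ¬ (T.q₁ = 0 ∧ T.q₂ = 0 ∧ T.s₁ = 0 ∧ T.s₂ = 0)

end Torsion

/-- The values of the invariants `u, v, v̂, z, w, t₁` of a Type III structure with `t₂ ≠ 0`, in the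
normalization `t₂ = 1`. -/
structure TypeIIIInvariants where
  (u v vhat z w : ℂ)
  (t₁ : ℝ)

namespace TypeIIIInvariants

/-- The invariants `N` are those of the torsion `T`. -/
structure Of (N : TypeIIIInvariants) (T : Torsion) : Prop where
  q₁ : T.q₁ = I * (N.t₁ : ℂ) * N.z
  q₂ : T.q₂ = N.z
  s₂ : T.s₂ = I * (N.t₁ : ℂ) * N.w
  s₁ : T.s₁ = N.w
  p₁ : T.p₁ + 4 * I * T.p₄ = 6 * N.u
  p₂ : T.p₂ = - 6 * (N.t₁ : ℂ) * N.u
  v : T.p₃ + 4 * T.p₄ = 24 * N.v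
  vhat : - T.p₃ + 4 * T.p₄ = 24 * N.vhat

/-- `a₁ = 24 Re v`. -/
def a₁ (N : TypeIIIInvariants) : ℝ := 24 * N.v.re

/-- `a₂ = 24 Im v`. -/
def a₂ (N : TypeIIIInvariants) : ℝ := 24 * N.v.im

/-- `a₀ = 3 t₁`. -/
def a₀ (N : TypeIIIInvariants) : ℝ := 3 * N.t₁

end TypeIIIInvariants

/-- The cohomogeneity-two structure `(Ω, Υ)` on `U`, with orbit tangent spaces `W`, is of Type III
with `u = 0`, at all points of the bundle `P` over `U`. -/
def IsTypeIIIWithUZero (U : Set R6) (Ω : TwoForm) (Υ : ThreeFormC)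
    (W : R6 → Submodule ℝ R6) : Prop :=
  ∀ y ∈ U, ∀ f : R6 →L[ℝ] R6, IsO2Coframe Ω Υ W y f →
    ∃ (T : Torsion) (N : TypeIIIInvariants),
      T.IsAt Ω Υ W y f ∧ T.IsTypeIII ∧ N.Of T ∧ N.u = 0

end NK

end

/-!
The model is `ℍˣ × ℂ`, with `ℍˣ` acting by left multiplication on the first factor; its Lie algebra
is `ℍ ≅ 𝔰𝔲(2) ⊕ 𝔲(1)`. When `u = 0`, the structure equations of `ω¹, …, ω⁶` and
`β = α + ω³ - a₀ ω⁶` contain, with `a = a₁ + i a₂`, the closed system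
`dη = i β ∧ η`, `dβ = 3 (1 + a₀²) ω¹ ∧ ω²`, `da₀ = -2 a₀ (a₁ ω¹ + a₂ ω²)`,
`da = i a β + (a₀² - 3) η - a (a₁ ω¹ + a₂ ω²)` on the surface of orbits. This system has a
rotationally symmetric solution on `ℂ` for each value `s` of `a₀` at the origin, and as `s` and the
point of `ℂ` vary, the invariants `(a₁, a₂, a₀)` take every value in `ℝ³`.

Over such a solution the remaining equations say that suitable combinations of `ω³, …, ω⁶`, `η` and
`β` satisfy the Maurer–Cartan equations of `ℍˣ`, so they are solved for `ω³, …, ω⁶` in terms of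
`g⁻¹ dg`; `ω⁶` comes from its real part, whose closedness is the equation for `dω⁶`. The equations
for `dΩ` and `dΥ` follow algebraically. Any other `O(2)`-coframe differs from this one by an element
of `O(2) ⊂ SU(3)`, which rotates or reflects `a` and so preserves Type III and `u = 0`.
-/

noncomputable section

namespace NK

section Units

open VectorField

variable {R : Type*} [NormedRing R] [NormedAlgebra ℝ R]

/-- The vector field `x ↦ x v` on the algebra `R`. -/
def mulRightField (v x : R) : TangentSpace 𝓘(ℝ, R) x := (x * v : R)

lemma hasFDerivAt_mulRightField (v x : R) :
    HasFDerivAt (mulRightField v) ((ContinuousLinearMap.mul ℝ R).flip v) x :=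
  ((ContinuousLinearMap.mul ℝ R).flip v).hasFDerivAt

lemma mdifferentiableAt_mulRightField (v x : R) :
    MDifferentiableAt 𝓘(ℝ, R) 𝓘(ℝ, R).tangent
      (fun x : R => (mulRightField v x : TangentBundle 𝓘(ℝ, R) R)) x :=
  (contMDiffAt_vectorSpace_iff_contDiffAt.2
    (((ContinuousLinearMap.mul ℝ R).flip v).contDiff (n := 1)).contDiffAt).mdifferentiableAt
      (by simp)

lemma lieBracket_mulRightField (v w : R) :
    lieBracket ℝ (fun x : R => x * v) (fun x : R => x * w) 1 = v * w - w * v := by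
  rw [lieBracket_eq]
  change fderiv ℝ (mulRightField w) (1 : R) (mulRightField v 1) -
    fderiv ℝ (mulRightField v) (1 : R) (mulRightField w 1) = _
  rw [(hasFDerivAt_mulRightField v 1).fderiv, (hasFDerivAt_mulRightField w 1).fderiv]
  change (1 * v) * w - (1 * w) * v = v * w - w * v
  rw [one_mul, one_mul]

variable [CompleteSpace R]

lemma hasMFDerivAt_unitsVal (g : Rˣ) :
    HasMFDerivAt 𝓘(ℝ, R) 𝓘(ℝ, R) (Units.val : Rˣ → R) g (ContinuousLinearMap.id ℝ R) := by
  refine ⟨Units.continuous_val.continuousAt, ?_⟩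
  have h : (writtenInExtChartAt 𝓘(ℝ, R) 𝓘(ℝ, R) g (Units.val : Rˣ → R)) =ᶠ[𝓝 (g : R)] id := by
    filter_upwards [Units.isOpenEmbedding_val.isOpen_range.mem_nhds (mem_range_self g)] with x hx
    obtain ⟨k, rfl⟩ := hx
    have : (extChartAt 𝓘(ℝ, R) g).symm (extChartAt 𝓘(ℝ, R) g k) = k :=
      (extChartAt 𝓘(ℝ, R) g).left_inv (by simp)
    exact congrArg Units.val this
  exact ((hasFDerivAt_id (𝕜 := ℝ) (g : R)).congr_of_eventuallyEq h).hasFDerivWithinAt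

/-- An element of `R`, seen in the Lie algebra of `Rˣ`: the chart of `Rˣ` is the inclusion into `R`,
so the tangent space at `1` is `R`. -/
def toLie (v : R) : GroupLieAlgebra 𝓘(ℝ, R) Rˣ := v

lemma mulInvariantVectorField_toLie (v : R) (g : Rˣ) :
    mulInvariantVectorField (toLie v) g = mulRightField v (g : R) := by
  have hmul : MDifferentiableAt 𝓘(ℝ, R) 𝓘(ℝ, R) (fun x : Rˣ => g * x) 1 :=
    (contMDiff_mul_left (I := 𝓘(ℝ, R)) (n := 1) (a := g)).mdifferentiableAt (by simp)
  have hval : HasMFDerivAt 𝓘(ℝ, R) 𝓘(ℝ, R) (fun x : R => (g : R) * x) ((1 : Rˣ) : R)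
      (ContinuousLinearMap.mul ℝ R (g : R)) :=
    (ContinuousLinearMap.mul ℝ R (g : R)).hasFDerivAt.hasMFDerivAt
  have h := hasMFDerivAt_unique ((hasMFDerivAt_unitsVal (g * 1)).comp 1 hmul.hasMFDerivAt)
    (hval.comp (1 : Rˣ) (hasMFDerivAt_unitsVal (1 : Rˣ)))
  exact congrArg (fun L : R →L[ℝ] R => L v) h

lemma mpullback_mulRightField (v : R) :
    mpullback 𝓘(ℝ, R) 𝓘(ℝ, R) (Units.val : Rˣ → R) (mulRightField v) =
      mulInvariantVectorField (toLie v) := by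
  funext g
  refine Eq.trans ?_ (mulInvariantVectorField_toLie v g).symm
  rw [mpullback_apply, (hasMFDerivAt_unitsVal g).mfderiv]
  exact congrArg (fun L : R →L[ℝ] R => L ((g : R) * v)) ContinuousLinearMap.inverse_id

lemma bracket_toLie (v w : R) : ⁅toLie v, toLie w⁆ = toLie (v * w - w * v) := by
  have h := mpullback_mlieBracket (n := minSmoothness ℝ 2)
    (mdifferentiableAt_mulRightField v ((1 : Rˣ) : R))
    (mdifferentiableAt_mulRightField w ((1 : Rˣ) : R))
    (Units.contMDiff_val (𝕜 := ℝ)).contMDiffAt le_rfl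
  rw [mpullback_mulRightField, mpullback_mulRightField] at h
  rw [GroupLieAlgebra.bracket_def]
  refine h.symm.trans ?_
  rw [mpullback_apply, (hasMFDerivAt_unitsVal (1 : Rˣ)).mfderiv, ← mlieBracketWithin_univ,
    mlieBracketWithin_eq_lieBracketWithin]
  refine (congrArg (fun L : R →L[ℝ] R => L _) ContinuousLinearMap.inverse_id).trans ?_
  refine Eq.trans ?_ (lieBracket_mulRightField v w)
  rw [← lieBracketWithin_univ]
  rfl

end Units

section QuaternionLieAlgebra

open Quaternion
attribute [local instance] LieRing.ofAssociativeRing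

lemma su2_ext {A B : su 2} (h₀ : (A.1 0 0).im = (B.1 0 0).im) (h₁ : A.1 0 1 = B.1 0 1) :
    A = B := by
  obtain ⟨A, hA, hA'⟩ := A
  obtain ⟨B, hB, hB'⟩ := B
  rw [Matrix.trace_fin_two] at hA' hB'
  have hA₀ := congr(($hA 0 0).re)
  have hB₀ := congr(($hB 0 0).re)
  have hA₁ := congr($hA 1 0)
  have hB₁ := congr($hB 1 0)
  simp only [Matrix.conjTranspose_apply, Matrix.neg_apply, Complex.star_def, conj_re,
    neg_re] at h₀ h₁ hA₀ hB₀ hA₁ hB₁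
  have h₀₀ : A 0 0 = B 0 0 := Complex.ext (by linarith) h₀
  have h₁₀ : A 1 0 = B 1 0 := neg_injective (by rw [← hA₁, ← hB₁, h₁])
  have h₁₁ : A 1 1 = B 1 1 := by
    rw [eq_neg_of_add_eq_zero_right hA', eq_neg_of_add_eq_zero_right hB', h₀₀]
  ext i j
  fin_cases i <;> fin_cases j
  exacts [h₀₀, h₁, h₁₀, h₁₁]

lemma u1_ext {A B : u 1} (h₀ : (A.1 0 0).im = (B.1 0 0).im) : A = B := by
  obtain ⟨A, hA⟩ := A
  obtain ⟨B, hB⟩ := B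
  change Aᴴ = -A at hA
  change Bᴴ = -B at hB
  have hA₀ := congr(($hA 0 0).re)
  have hB₀ := congr(($hB 0 0).re)
  simp only [Matrix.conjTranspose_apply, Matrix.neg_apply, Complex.star_def, conj_re,
    neg_re] at h₀ hA₀ hB₀
  have h₀₀ : A 0 0 = B 0 0 := Complex.ext (by linarith) h₀
  ext i j
  fin_cases i; fin_cases j
  exact h₀₀

/-- The projection of `ℍ ≅ 𝔰𝔲(2) ⊕ 𝔲(1)` to `𝔰𝔲(2)`, which kills the real quaternions. -/
def toSU2 (p : ℍ[ℝ]) : su 2 where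
  val := !![⟨0, p.imI⟩, ⟨p.imJ, p.imK⟩; ⟨-p.imJ, p.imK⟩, ⟨0, -p.imI⟩]
  property := by
    constructor
    · ext i j
      fin_cases i <;> fin_cases j <;> simp [Complex.ext_iff]
    · simp [Matrix.trace_fin_two, Complex.ext_iff]

/-- The projection of `ℍ ≅ 𝔰𝔲(2) ⊕ 𝔲(1)` to `𝔲(1)`, which kills the imaginary quaternions. -/
def toU1 (p : ℍ[ℝ]) : u 1 where
  val := !![⟨0, p.re⟩]
  property := by
    change (!![⟨0, p.re⟩])ᴴ = -!![(⟨0, p.re⟩ : ℂ)]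
    ext i j
    fin_cases i; fin_cases j
    simp [Complex.ext_iff]

/-- The isomorphism `ℍ ≅ 𝔰𝔲(2) ⊕ 𝔲(1)`. -/
def quaternionEquiv : ℍ[ℝ] ≃ₗ[ℝ] (su 2 × u 1) where
  toFun p := (toSU2 p, toU1 p)
  map_add' p q := Prod.ext (su2_ext (by simp [toSU2]) (by simp [toSU2, Complex.ext_iff]))
    (u1_ext (by simp [toU1]))
  map_smul' c p := Prod.ext (su2_ext (by simp [toSU2]) (by simp [toSU2, Complex.ext_iff]))
    (u1_ext (by simp [toU1]))
  invFun m := ⟨(m.2.1 0 0).im, (m.1.1 0 0).im, (m.1.1 0 1).re, (m.1.1 0 1).im⟩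
  left_inv p := by ext <;> simp [toSU2, toU1]
  right_inv m := Prod.ext (su2_ext (by simp [toSU2]) (by simp [toSU2])) (u1_ext (by simp [toU1]))

lemma toSU2_commutator (p q : ℍ[ℝ]) : toSU2 (p * q - q * p) = ⁅toSU2 p, toSU2 q⁆ := by
  have hsu : ∀ A B : su 2, (⁅A, B⁆ : su 2).1 = A.1 * B.1 - B.1 * A.1 := fun _ _ => rfl
  refine su2_ext ?_ (Complex.ext ?_ ?_) <;> rw [hsu] <;>
    simp [toSU2] <;> ring

lemma toU1_commutator (p q : ℍ[ℝ]) : toU1 (p * q - q * p) = ⁅toU1 p, toU1 q⁆ := by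
  have hu : ∀ A B : u 1, (⁅A, B⁆ : u 1).1 = A.1 * B.1 - B.1 * A.1 := fun _ _ => rfl
  refine u1_ext ?_
  rw [hu]
  simp [toU1]
  ring

theorem hasLieAlgebraSU2U1_quaternion_units : HasLieAlgebraSU2U1 ℍ[ℝ] ℍ[ℝ]ˣ :=
  ⟨quaternionEquiv, fun X Y =>
    (congrArg quaternionEquiv (bracket_toLie (R := ℍ[ℝ]) X Y)).trans
      (Prod.ext (toSU2_commutator X Y) (toU1_commutator X Y))⟩

end QuaternionLieAlgebra

section Forms

/-- The standard 2-form on `ℝ⁶` as an alternating map. -/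
def stdOmegaForm : R6 [⋀^Fin 2]→L[ℝ] ℝ where
  toFun v := stdOmega (v 0) (v 1)
  map_update_add' {inst} v i x y := by
    obtain rfl := Subsingleton.elim inst (instDecidableEqFin 2)
    fin_cases i <;> simp [stdOmega] <;> ring
  map_update_smul' {inst} v i c x := by
    obtain rfl := Subsingleton.elim inst (instDecidableEqFin 2)
    fin_cases i <;> simp [stdOmega] <;> ring
  cont := by
    unfold stdOmega
    fun_prop
  map_eq_zero_of_eq' v i j h hij := by
    fin_cases i <;> fin_cases j <;> simp_all [stdOmega] <;> ring

/-- The identification `ℝ⁶ ≅ ℂ³` as a real linear map. -/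
def zCoordL : R6 →ₗ[ℝ] Fin 3 → ℂ where
  toFun := zCoord
  map_add' v w := by
    ext i
    fin_cases i <;> simp [zCoord] <;> ring
  map_smul' c v := by
    ext i
    fin_cases i <;> simp [zCoord] <;> ring

lemma zCoord_sub (v w : R6) : zCoord (v - w) = zCoord v - zCoord w := map_sub zCoordL v w

/-- The standard complex volume form on `ℝ⁶` as an alternating map. -/
def stdUpsilonForm : R6 [⋀^Fin 3]→L[ℝ] ℂ :=
  let detForm : (Fin 3 → ℂ) [⋀^Fin 3]→L[ℂ] ℂ :=
    { toAlternatingMap := Matrix.detRowAlternating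
      cont := continuous_id.matrix_det }
  (detForm.restrictScalars ℝ).compContinuousLinearMap zCoordL.toContinuousLinearMap

lemma stdOmegaForm_apply (v : Fin 2 → R6) : stdOmegaForm v = stdOmega (v 0) (v 1) := rfl

lemma stdUpsilonForm_apply (v : Fin 3 → R6) : stdUpsilonForm v = stdUpsilon v :=
  Matrix.det_transpose (Matrix.of fun i j => zCoord (v j) i)

lemma stdUpsilon_eq (v : Fin 3 → R6) : stdUpsilon v =
    zCoord (v 0) 0 * zCoord (v 1) 1 * zCoord (v 2) 2
    - zCoord (v 1) 0 * zCoord (v 0) 1 * zCoord (v 2) 2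
    + zCoord (v 1) 0 * zCoord (v 2) 1 * zCoord (v 0) 2
    - zCoord (v 0) 0 * zCoord (v 2) 1 * zCoord (v 1) 2
    - zCoord (v 2) 0 * zCoord (v 1) 1 * zCoord (v 0) 2
    + zCoord (v 2) 0 * zCoord (v 0) 1 * zCoord (v 1) 2 := by
  simp only [stdUpsilon, Matrix.det_fin_three, Matrix.of_apply]
  ring

/-- The 2-form for which `σ` is a field of `SU(3)`-coframes. -/
def omegaOf (σ : R6 → R6 →L[ℝ] R6) : TwoForm :=
  fun y => stdOmegaForm.compContinuousLinearMap (σ y)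

/-- The complex 3-form for which `σ` is a field of `SU(3)`-coframes. -/
def upsilonOf (σ : R6 → R6 →L[ℝ] R6) : ThreeFormC :=
  fun y => stdUpsilonForm.compContinuousLinearMap (σ y)

lemma omegaOf_apply (σ : R6 → R6 →L[ℝ] R6) (y : R6) (v : Fin 2 → R6) :
    omegaOf σ y v = stdOmega (σ y (v 0)) (σ y (v 1)) := rfl

lemma upsilonOf_apply (σ : R6 → R6 →L[ℝ] R6) (y : R6) (v : Fin 3 → R6) :
    upsilonOf σ y v = stdUpsilon fun i => σ y (v i) := stdUpsilonForm_apply _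

lemma isSU3Coframe_of_bijective (σ : R6 → R6 →L[ℝ] R6) {y : R6} (h : Function.Bijective (σ y)) :
    IsSU3Coframe (omegaOf σ) (upsilonOf σ) y (σ y) :=
  ⟨h, omegaOf_apply σ y, upsilonOf_apply σ y⟩

end Forms

section ExteriorDerivative

variable {E E' F F' : Type*} [NormedAddCommGroup E] [NormedSpace ℝ E]
  [NormedAddCommGroup E'] [NormedSpace ℝ E'] [NormedAddCommGroup F] [NormedSpace ℝ F]
  [NormedAddCommGroup F'] [NormedSpace ℝ F'] {k : ℕ}

/-- The exterior derivative at `y` of a vector-valued one-form `φ`, evaluated on `v, w`. -/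
def extDerivOneForm (φ : E → E →L[ℝ] F) (y v w : E) : F := fderiv ℝ φ y v w - fderiv ℝ φ y w v

lemma extDerivOneForm_clm_comp (L : F →L[ℝ] F') {φ : E → E →L[ℝ] F} {y : E}
    (hφ : DifferentiableAt ℝ φ y) (v w : E) :
    extDerivOneForm (fun z => L ∘L φ z) y v w = L (extDerivOneForm φ y v w) := by
  have hL : HasFDerivAt (fun z => L ∘L φ z) _ y :=
    (ContinuousLinearMap.compL ℝ E F F' L).hasFDerivAt.comp y hφ.hasFDerivAt
  rw [extDerivOneForm, hL.fderiv, extDerivOneForm, map_sub]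
  rfl

lemma contDiffOn_of_forall_apply [FiniteDimensional ℝ E] [FiniteDimensional ℝ F]
    {n : WithTop ℕ∞} {φ : E' → E [⋀^Fin k]→L[ℝ] F} {U : Set E'}
    (h : ∀ v, ContDiffOn ℝ n (fun y => φ y v) U) : ContDiffOn ℝ n φ U := by
  let b := Module.finBasis ℝ E
  let ev : (E [⋀^Fin k]→L[ℝ] F) →ₗ[ℝ] ((Fin k → Fin (Module.finrank ℝ E)) → F) :=
    { toFun := fun m s => m (fun i => b (s i))
      map_add' := fun _ _ => rfl
      map_smul' := fun _ _ => rfl }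
  have hev : Function.Injective ev := fun m n hmn =>
    ContinuousAlternatingMap.toAlternatingMap_injective <|
      AlternatingMap.coe_multilinearMap_injective <|
        Module.Basis.ext_multilinear (fun _ => b) fun s => congrFun hmn s
  obtain ⟨L, hL⟩ := ev.exists_leftInverse_of_injective (LinearMap.ker_eq_bot.2 hev)
  have hφ : φ = fun y => LinearMap.toContinuousLinearMap L (ev (φ y)) :=
    funext fun y => (LinearMap.congr_fun hL (φ y)).symm
  rw [hφ]
  exact (LinearMap.toContinuousLinearMap L).contDiff.comp_contDiffOn
    (contDiffOn_pi.2 fun s => h _)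

lemma contDiffOn_compContinuousLinearMap [FiniteDimensional ℝ E] [FiniteDimensional ℝ F']
    {n : WithTop ℕ∞} (M : F [⋀^Fin k]→L[ℝ] F') {σ : E' → E →L[ℝ] F} {U : Set E'}
    (hσ : ContDiffOn ℝ n σ U) : ContDiffOn ℝ n (fun y => M.compContinuousLinearMap (σ y)) U :=
  contDiffOn_of_forall_apply fun _ => M.toContinuousMultilinearMap.contDiff.comp_contDiffOn
    (contDiffOn_pi.2 fun _ => hσ.clm_apply contDiffOn_const)

lemma extDeriv_compContinuousAlternatingMap (L : F →L[ℝ] F') {φ : E → E [⋀^Fin k]→L[ℝ] F} {y : E}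
    (hφ : DifferentiableAt ℝ φ y) :
    extDeriv (fun z => L.compContinuousAlternatingMap (φ z)) y =
      L.compContinuousAlternatingMap (extDeriv φ y) := by
  have hL : HasFDerivAt (fun z => L.compContinuousAlternatingMap (φ z)) _ y :=
    (ContinuousLinearMap.compContinuousAlternatingMapCLM (ι := Fin k) ℝ E F F' L).hasFDerivAt.comp y
      hφ.hasFDerivAt
  ext v
  rw [extDeriv, hL.fderiv, extDeriv, ContinuousAlternatingMap.alternatizeUncurryFin_apply,
    ContinuousLinearMap.compContinuousAlternatingMap_coe, Function.comp_apply,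
    ContinuousAlternatingMap.alternatizeUncurryFin_apply, map_sum]
  refine Finset.sum_congr rfl fun i _ => ?_
  rw [map_zsmul]
  rfl

lemma extDeriv_compContinuousLinearMap_apply (M : F [⋀^Fin k]→L[ℝ] F') {σ : E → E →L[ℝ] F} {y : E}
    (hσ : DifferentiableAt ℝ σ y) (v : Fin (k + 1) → E) :
    extDeriv (fun z => M.compContinuousLinearMap (σ z)) y v =
      ∑ i, (-1) ^ i.val • ∑ j, M (Function.update (fun l => σ y (i.removeNth v l)) j
        (fderiv ℝ σ y (v i) (i.removeNth v j))) := by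
  have hd : DifferentiableAt ℝ (fun z => M.compContinuousLinearMap (σ z)) y :=
    (differentiableAt_const M).continuousAlternatingMapCompContinuousLinearMap hσ
  rw [extDeriv_apply hd]
  refine Finset.sum_congr rfl fun i _ => congrArg _ ?_
  have hσi : HasFDerivAt (fun z l => σ z (i.removeNth v l))
      (ContinuousLinearMap.pi fun l => (fderiv ℝ σ y).flip (i.removeNth v l)) y :=
    hasFDerivAt_pi.2 fun l => by
      simpa using hσ.hasFDerivAt.clm_apply (hasFDerivAt_const (i.removeNth v l) y)
  have hM := (M.hasFDerivAt fun l => σ y (i.removeNth v l)).comp y hσi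
  change fderiv ℝ (M ∘ fun z l => σ z (i.removeNth v l)) y (v i) = _
  rw [hM.fderiv, ContinuousLinearMap.comp_apply, ContinuousMultilinearMap.linearDeriv_apply]
  rfl

end ExteriorDerivative

section ReducedEquations

variable {E : Type*} [NormedAddCommGroup E] [NormedSpace ℝ E]

/-- The wedge product of the components `i` and `j` of a coframe, evaluated on `v, w`. -/
def wedgeComp (f : E →L[ℝ] R6) (i j : Fin 6) (v w : E) : ℝ := f v i * f w j - f w i * f v j

/-- The wedge product of a covector and the component `j` of a coframe, evaluated on `v, w`. -/
def wedgeConn (β : E →ₗ[ℝ] ℝ) (f : E →L[ℝ] R6) (j : Fin 6) (v w : E) : ℝ :=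
  β v * f w j - β w * f v j

/-- The structure equations of a Type III structure with `u = 0`, in real form and with the
connection form `α` replaced by `β = α + ω³ - a₀ ω⁶`. The field `dᵢ` computes `dωⁱ`, while
`wedgeComp` and `wedgeConn` count the components of the coframe from `0`. -/
structure ReducedEquations (f : E →L[ℝ] R6) (df : E → E → R6) (β : E →ₗ[ℝ] ℝ)
    (a₁ a₂ a₀ : ℝ) : Prop where
  d₁ : ∀ v w, df v w 0 = -wedgeConn β f 1 v w
  d₂ : ∀ v w, df v w 1 = wedgeConn β f 0 v w
  d₃ : ∀ v w, df v w 2 = wedgeComp f 0 1 v w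
    + a₀ * (wedgeComp f 0 4 v w - wedgeComp f 1 3 v w) - 3 * wedgeComp f 3 4 v w
    - (a₁ * wedgeComp f 3 5 v w + a₂ * wedgeComp f 4 5 v w)
  d₄ : ∀ v w, df v w 3 = a₀ * wedgeComp f 1 2 v w - wedgeComp f 1 5 v w - wedgeConn β f 4 v w
    - 3 * wedgeComp f 4 2 v w + a₀ * wedgeComp f 4 5 v w + a₁ * wedgeComp f 2 5 v w
  d₅ : ∀ v w, df v w 4 = -a₀ * wedgeComp f 0 2 v w + wedgeComp f 0 5 v w + wedgeConn β f 3 v w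
    + 3 * wedgeComp f 3 2 v w - a₀ * wedgeComp f 3 5 v w + a₂ * wedgeComp f 2 5 v w
  d₆ : ∀ v w, df v w 5 = -2 * a₀ * wedgeComp f 0 1 v w
    + (a₁ * wedgeComp f 0 5 v w + a₂ * wedgeComp f 1 5 v w)

lemma ReducedEquations.comp {E' : Type*} [NormedAddCommGroup E'] [NormedSpace ℝ E']
    {f : E →L[ℝ] R6} {df : E → E → R6} {β : E →ₗ[ℝ] ℝ} {a₁ a₂ a₀ : ℝ}
    (h : ReducedEquations f df β a₁ a₂ a₀) (T : E' →L[ℝ] E) :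
    ReducedEquations (f ∘L T) (fun v w => df (T v) (T w)) (β ∘ₗ T.toLinearMap) a₁ a₂ a₀ where
  d₁ v w := h.d₁ (T v) (T w)
  d₂ v w := h.d₂ (T v) (T w)
  d₃ v w := h.d₃ (T v) (T w)
  d₄ v w := h.d₄ (T v) (T w)
  d₅ v w := h.d₅ (T v) (T w)
  d₆ v w := h.d₆ (T v) (T w)

/-- The torsion of a Type III structure with `u = 0`. -/
def reducedTorsion (a₁ a₂ a₀ : ℝ) : Torsion where
  p₁ := 0
  p₂ := 0
  p₃ := ⟨a₁, a₂⟩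
  p₄ := 0
  q₁ := 0
  q₂ := 0
  r := 0
  h₁ := 0
  h₂ := 0
  h₃ := 0
  h₄ := a₀

/-- The invariants of a Type III structure with `u = 0`. -/
def reducedInvariants (a₁ a₂ a₀ : ℝ) : TypeIIIInvariants where
  u := 0
  v := ⟨a₁ / 24, a₂ / 24⟩
  vhat := ⟨-(a₁ / 24), -(a₂ / 24)⟩
  z := 0
  w := 3
  t₁ := a₀ / 3

variable (a₁ a₂ a₀ : ℝ)

lemma reducedInvariants_of : (reducedInvariants a₁ a₂ a₀).Of (reducedTorsion a₁ a₂ a₀) where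
  q₁ := by simp [reducedInvariants, reducedTorsion]
  q₂ := by simp [reducedInvariants, reducedTorsion]
  s₂ := by simp [reducedInvariants, reducedTorsion, Torsion.s₂, Complex.ext_iff]
  s₁ := by simp [reducedInvariants, reducedTorsion, Torsion.s₁]
  p₁ := by simp [reducedInvariants, reducedTorsion]
  p₂ := by simp [reducedInvariants, reducedTorsion]
  v := by apply Complex.ext <;> simp [reducedInvariants, reducedTorsion] <;> ring
  vhat := by apply Complex.ext <;> simp [reducedInvariants, reducedTorsion] <;> ring

lemma reducedInvariants_a₁ : (reducedInvariants a₁ a₂ a₀).a₁ = a₁ :=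
  mul_div_cancel₀ a₁ (by norm_num)

lemma reducedInvariants_a₂ : (reducedInvariants a₁ a₂ a₀).a₂ = a₂ :=
  mul_div_cancel₀ a₂ (by norm_num)

lemma reducedInvariants_a₀ : (reducedInvariants a₁ a₂ a₀).a₀ = a₀ :=
  mul_div_cancel₀ a₀ (by norm_num)

lemma reducedTorsion_isTypeIII : (reducedTorsion a₁ a₂ a₀).IsTypeIII := by
  refine ⟨by simp [reducedTorsion], by simp [reducedTorsion, Torsion.s₁, Torsion.s₂], ?_⟩
  rintro ⟨-, -, hs₁, -⟩
  simp [reducedTorsion, Torsion.s₁] at hs₁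

variable {a₁ a₂ a₀} {f : R6 →L[ℝ] R6} {df : R6 → R6 → R6} {β : R6 →ₗ[ℝ] ℝ}

lemma ReducedEquations.structureEquations (h : ReducedEquations f df β a₁ a₂ a₀) :
    ∃ α : R6 →ₗ[ℝ] ℝ, (reducedTorsion a₁ a₂ a₀).StructureEquations f df α := by
  let comp (i : Fin 6) : R6 →ₗ[ℝ] ℝ := (EuclideanSpace.proj i ∘L f).toLinearMap
  refine ⟨β - comp 2 + a₀ • comp 5, fun v w => ?_, fun v w => ?_, fun v w => ?_, fun v w => ?_⟩
  · rw [h.d₁, h.d₂]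
    apply Complex.ext <;>
      simp [comp, wedge, cbar, eta, theta, omega3, omega6, Torsion.xi₀, Torsion.xi₁, Torsion.xi₂,
        Torsion.xi₃, reducedTorsion, wedgeConn] <;> ring
  · rw [h.d₃]
    apply Complex.ext <;>
      simp [wedge, cbar, eta, theta, omega3, omega6, Torsion.xi₀, Torsion.xi₁, Torsion.xi₂,
        reducedTorsion, wedgeComp] <;> ring
  · rw [h.d₄, h.d₅]
    apply Complex.ext <;>
      simp [comp, wedge, cbar, eta, theta, omega3, omega6, Torsion.xi₀, Torsion.xi₁, Torsion.xi₂,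
        Torsion.xi₃, reducedTorsion, wedgeComp, wedgeConn] <;> ring
  · rw [h.d₆]
    apply Complex.ext <;>
      simp [wedge, cbar, eta, theta, omega3, omega6, Torsion.xi₀, Torsion.xi₁, Torsion.xi₂,
        reducedTorsion, wedgeComp] <;> ring

end ReducedEquations

section NearlyKahler

variable {σ : R6 → R6 →L[ℝ] R6} {y : R6} {β : R6 →ₗ[ℝ] ℝ} {a₁ a₂ a₀ : ℝ}

lemma extDeriv_omegaOf (hσ : DifferentiableAt ℝ σ y) (v : Fin 3 → R6) :
    extDeriv (omegaOf σ) y v =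
      stdOmega (extDerivOneForm σ y (v 0) (v 1)) (σ y (v 2))
      - stdOmega (extDerivOneForm σ y (v 0) (v 2)) (σ y (v 1))
      + stdOmega (extDerivOneForm σ y (v 1) (v 2)) (σ y (v 0)) := by
  unfold omegaOf
  rw [extDeriv_compContinuousLinearMap_apply stdOmegaForm hσ v]
  simp [Fin.sum_univ_succ, stdOmegaForm_apply, Fin.removeNth, stdOmega, extDerivOneForm]
  ring

/-- The exterior derivative of the complex volume form in terms of the coframe `f` and its exterior
derivative `df`. -/
def dUpsilon (f : R6 →L[ℝ] R6) (df : R6 → R6 → R6) (v : Fin 4 → R6) : ℂ :=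
  stdUpsilon ![df (v 0) (v 1), f (v 2), f (v 3)] - stdUpsilon ![df (v 0) (v 2), f (v 1), f (v 3)]
  + stdUpsilon ![df (v 0) (v 3), f (v 1), f (v 2)] + stdUpsilon ![df (v 1) (v 2), f (v 0), f (v 3)]
  - stdUpsilon ![df (v 1) (v 3), f (v 0), f (v 2)] + stdUpsilon ![df (v 2) (v 3), f (v 0), f (v 1)]

lemma extDeriv_upsilonOf (hσ : DifferentiableAt ℝ σ y) (v : Fin 4 → R6) :
    extDeriv (upsilonOf σ) y v = dUpsilon (σ y) (extDerivOneForm σ y) v := by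
  unfold upsilonOf
  rw [extDeriv_compContinuousLinearMap_apply stdUpsilonForm hσ v]
  have succAbove_one : Fin.succAbove (1 : Fin 4) (2 : Fin 3) = 3 := rfl
  have succAbove_two : Fin.succAbove (2 : Fin 4) (2 : Fin 3) = 3 := rfl
  have succAbove_three : Fin.succAbove (3 : Fin 4) (2 : Fin 3) = 2 := rfl
  simp [succAbove_one, succAbove_two, succAbove_three, Fin.sum_univ_succ, stdUpsilonForm_apply,
    Fin.removeNth, stdUpsilon_eq, extDerivOneForm, dUpsilon, zCoord_sub, Function.update_of_ne]
  ring

lemma ReducedEquations.extDeriv_omegaOf (hσ : DifferentiableAt ℝ σ y)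
    (h : ReducedEquations (σ y) (extDerivOneForm σ y) β a₁ a₂ a₀) :
    extDeriv (omegaOf σ) y = (3 : ℝ) • imPart (upsilonOf σ) y := by
  ext v
  rw [NK.extDeriv_omegaOf hσ]
  change _ = 3 * (upsilonOf σ y v).im
  rw [upsilonOf_apply, stdUpsilon_eq]
  simp only [stdOmega, h.d₁, h.d₂, h.d₃, h.d₄, h.d₅, h.d₆]
  simp [zCoord, wedgeComp, wedgeConn]
  ring

set_option maxHeartbeats 1000000 in
-- `ring` has to compare polynomials of degree four in the 24 components of the `f (v i)`.
lemma ReducedEquations.dUpsilon_eq {f : R6 →L[ℝ] R6} {df : R6 → R6 → R6}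
    (h : ReducedEquations f df β a₁ a₂ a₀) (v : Fin 4 → R6) :
    dUpsilon f df v =
      (4 * (stdOmega (f (v 0)) (f (v 1)) * stdOmega (f (v 2)) (f (v 3))
        - stdOmega (f (v 0)) (f (v 2)) * stdOmega (f (v 1)) (f (v 3))
        + stdOmega (f (v 0)) (f (v 3)) * stdOmega (f (v 1)) (f (v 2))) : ℝ) := by
  apply Complex.ext <;>
    simp [dUpsilon, stdUpsilon_eq, zCoord, h.d₁, h.d₂, h.d₃, h.d₄, h.d₅, h.d₆, wedgeComp,
      wedgeConn, stdOmega] <;> ring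

lemma ReducedEquations.extDeriv_upsilonOf (hσ : DifferentiableAt ℝ σ y)
    (h : ReducedEquations (σ y) (extDerivOneForm σ y) β a₁ a₂ a₀) (v : Fin 4 → R6) :
    extDeriv (upsilonOf σ) y v = (2 * omegaSq (omegaOf σ) y v : ℝ) := by
  rw [NK.extDeriv_upsilonOf hσ, h.dUpsilon_eq]
  simp only [omegaSq, omegaOf_apply, Matrix.cons_val_zero, Matrix.cons_val_one]
  push_cast
  ring

theorem isNearlyKahlerOn_of_reducedEquations {U : Set R6} (hU : IsOpen U)
    (hσ : ContDiffOn ℝ ∞ σ U) (hb : ∀ y ∈ U, Function.Bijective (σ y))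
    (h : ∀ y ∈ U, ∃ β a₁ a₂ a₀, ReducedEquations (σ y) (extDerivOneForm σ y) β a₁ a₂ a₀) :
    IsNearlyKahlerOn U (omegaOf σ) (upsilonOf σ) := by
  have hσd (y) (hy : y ∈ U) : DifferentiableAt ℝ σ y :=
    (hσ.contDiffAt (hU.mem_nhds hy)).differentiableAt (by simp)
  have hΥ : ContDiffOn ℝ ∞ (upsilonOf σ) U := contDiffOn_compContinuousLinearMap _ hσ
  have hΥd (y) (hy : y ∈ U) : DifferentiableAt ℝ (upsilonOf σ) y :=
    (hΥ.contDiffAt (hU.mem_nhds hy)).differentiableAt (by simp)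
  refine ⟨contDiffOn_compContinuousLinearMap _ hσ, hΥ,
    fun y hy => ⟨σ y, isSU3Coframe_of_bijective σ (hb y hy)⟩, fun y hy => ?_, fun y hy v => ?_,
    fun y hy => ?_⟩
  all_goals obtain ⟨β, a₁, a₂, a₀, he⟩ := h y hy
  · exact he.extDeriv_omegaOf (hσd y hy)
  · have hre := extDeriv_compContinuousAlternatingMap Complex.reCLM (hΥd y hy)
    exact (DFunLike.congr_fun hre v).trans
      (congrArg Complex.re (he.extDeriv_upsilonOf (hσd y hy) v))
  · ext v
    have him := extDeriv_compContinuousAlternatingMap Complex.imCLM (hΥd y hy)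
    exact (DFunLike.congr_fun him v).trans
      (congrArg Complex.im (he.extDeriv_upsilonOf (hσd y hy) v))

end NearlyKahler

section SU3

/-- The standard complex structure of `ℝ⁶ ≅ ℂ³`. -/
def complexStructure : R6 →ₗ[ℝ] R6 where
  toFun v := !₂[-v 3, -v 4, -v 5, v 0, v 1, v 2]
  map_add' v w := by
    ext i
    fin_cases i <;> simp <;> ring
  map_smul' c v := by
    ext i
    fin_cases i <;> simp

lemma zCoord_complexStructure (v : R6) : zCoord (complexStructure v) = I • zCoord v := by
  ext i
  fin_cases i <;> apply Complex.ext <;> simp [zCoord, complexStructure]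

lemma inner_eq (v w : R6) : inner ℝ v w =
    v 0 * w 0 + v 1 * w 1 + v 2 * w 2 + v 3 * w 3 + v 4 * w 4 + v 5 * w 5 := by
  simp only [PiLp.inner_apply, Fin.sum_univ_six, RCLike.inner_apply, conj_trivial, mul_comm]

lemma stdOmega_complexStructure (v w : R6) : stdOmega v (complexStructure w) = inner ℝ v w := by
  simp [stdOmega, complexStructure, inner_eq]
  ring

lemma stdUpsilon_complexStructure (x y z : R6) :
    stdUpsilon ![complexStructure x, y, z] = I * stdUpsilon ![x, y, z] := by
  simp [stdUpsilon_eq, zCoord_complexStructure]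
  ring

lemma zCoord_injective : Function.Injective zCoord := by
  intro x y h
  have hcoord (i : Fin 3) : zCoord x i = zCoord y i := congrFun h i
  have h₀ := hcoord 0
  have h₁ := hcoord 1
  have h₂ := hcoord 2
  simp only [zCoord, Complex.ext_iff] at h₀ h₁ h₂
  ext i
  fin_cases i <;> simp_all

lemma eq_of_forall_stdUpsilon_eq {x x' : R6}
    (h : ∀ y z, stdUpsilon ![x, y, z] = stdUpsilon ![x', y, z]) : x = x' := by
  have h₀ := h (EuclideanSpace.single 1 1) (EuclideanSpace.single 2 1)
  have h₁ := h (EuclideanSpace.single 2 1) (EuclideanSpace.single 0 1)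
  have h₂ := h (EuclideanSpace.single 0 1) (EuclideanSpace.single 1 1)
  simp only [stdUpsilon_eq] at h₀ h₁ h₂
  refine zCoord_injective (funext fun i => ?_)
  fin_cases i
  · simpa [zCoord] using h₀
  · simpa [zCoord] using h₁
  · simpa [zCoord] using h₂

/-- Membership in `SU(3)`, the stabilizer of the standard forms. -/
structure PreservesSU3 (A : R6 →L[ℝ] R6) : Prop where
  omega : ∀ v w, stdOmega (A v) (A w) = stdOmega v w
  upsilon : ∀ v : Fin 3 → R6, stdUpsilon (fun i => A (v i)) = stdUpsilon v

lemma IsSU3Coframe.exists_preservesSU3_comp {Ω : TwoForm} {Υ : ThreeFormC} {y : R6}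
    {s f : R6 →L[ℝ] R6} (hs : IsSU3Coframe Ω Υ y s) (hf : IsSU3Coframe Ω Υ y f) :
    ∃ A, PreservesSU3 A ∧ f = A ∘L s := by
  let e := (LinearEquiv.ofBijective s.toLinearMap hs.1).toContinuousLinearEquiv
  have hse (v : R6) : s (e.symm v) = v := e.apply_symm_apply v
  refine ⟨f ∘L e.symm, ⟨fun v w => ?_, fun v => ?_⟩, ?_⟩
  · have hΩ := (hf.2.1 ![e.symm v, e.symm w]).symm.trans (hs.2.1 ![e.symm v, e.symm w])
    simpa [hse] using hΩ
  · have hΥ := (hf.2.2 fun i => e.symm (v i)).symm.trans (hs.2.2 fun i => e.symm (v i))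
    simpa [hse] using hΥ
  · ext1 v
    exact congrArg f (e.symm_apply_apply v).symm

namespace PreservesSU3

variable {A B : R6 →L[ℝ] R6}

lemma bijective (hA : PreservesSU3 A) : Function.Bijective A := by
  have hinj : Function.Injective A := (injective_iff_map_eq_zero A).2 fun v hv => by
    rw [← inner_self_eq_zero (𝕜 := ℝ), ← stdOmega_complexStructure, ← hA.omega, hv]
    simp [stdOmega]
  exact ⟨hinj, LinearMap.injective_iff_surjective (f := A.toLinearMap).1 hinj⟩

lemma map_complexStructure (hA : PreservesSU3 A) (v : R6) :
    A (complexStructure v) = complexStructure (A v) := by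
  have hΥ (x y z : R6) : stdUpsilon ![A x, A y, A z] = stdUpsilon ![x, y, z] := by
    rw [← hA.upsilon ![x, y, z]]
    exact congrArg stdUpsilon (FinVec.map_eq A ![x, y, z])
  refine eq_of_forall_stdUpsilon_eq fun y z => ?_
  obtain ⟨y, rfl⟩ := hA.bijective.2 y
  obtain ⟨z, rfl⟩ := hA.bijective.2 z
  rw [hΥ, stdUpsilon_complexStructure, stdUpsilon_complexStructure, hΥ]

lemma inner_map_map (hA : PreservesSU3 A) (v w : R6) : inner ℝ (A v) (A w) = inner ℝ v w := by
  rw [← stdOmega_complexStructure, ← hA.map_complexStructure, hA.omega, stdOmega_complexStructure]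

lemma ext (hA : PreservesSU3 A) (hB : PreservesSU3 B)
    (h₀ : A (EuclideanSpace.single 0 1) = B (EuclideanSpace.single 0 1))
    (h₁ : A (EuclideanSpace.single 1 1) = B (EuclideanSpace.single 1 1))
    (h₂ : A (EuclideanSpace.single 2 1) = B (EuclideanSpace.single 2 1)) : A = B := by
  have expand (v : R6) : v =
      v 0 • EuclideanSpace.single 0 1 + v 1 • EuclideanSpace.single 1 1
      + v 2 • EuclideanSpace.single 2 1
      + v 3 • complexStructure (EuclideanSpace.single 0 1)
      + v 4 • complexStructure (EuclideanSpace.single 1 1)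
      + v 5 • complexStructure (EuclideanSpace.single 2 1) := by
    ext i
    fin_cases i <;> simp [complexStructure]
  ext1 v
  rw [expand v]
  simp only [map_add, map_smul, hA.map_complexStructure, hB.map_complexStructure, h₀, h₁, h₂]

end PreservesSU3

end SU3

section O2

/-- The element of `O(2) ⊂ SU(3)` with first column `(c, d)` and determinant `ε`. -/
def orth (c d ε : ℝ) : R6 →L[ℝ] R6 :=
  LinearMap.toContinuousLinearMap
    { toFun := fun v => !₂[c * v 0 - ε * d * v 1, d * v 0 + ε * c * v 1, ε * v 2,
        c * v 3 - ε * d * v 4, d * v 3 + ε * c * v 4, ε * v 5]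
      map_add' := fun v w => by
        ext i
        fin_cases i <;> simp <;> ring
      map_smul' := fun a v => by
        ext i
        fin_cases i <;> simp <;> ring }

variable {c d ε : ℝ}

lemma orth_apply (v : R6) : orth c d ε v = !₂[c * v 0 - ε * d * v 1, d * v 0 + ε * c * v 1,
    ε * v 2, c * v 3 - ε * d * v 4, d * v 3 + ε * c * v 4, ε * v 5] := rfl

lemma zCoord_orth (v : R6) : zCoord (orth c d ε v) = ![c * zCoord v 0 - ε * d * zCoord v 1,
    d * zCoord v 0 + ε * c * zCoord v 1, ε * zCoord v 2] := by
  ext i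
  fin_cases i <;> simp [zCoord, orth_apply] <;> ring

lemma orth_preservesSU3 (h : c ^ 2 + d ^ 2 = 1) (hε : ε ^ 2 = 1) : PreservesSU3 (orth c d ε) where
  omega v w := by
    simp [stdOmega, orth_apply]
    linear_combination (v 0 * w 3 - v 3 * w 0 + ε ^ 2 * (v 1 * w 4 - v 4 * w 1)) * h +
      (v 1 * w 4 - v 4 * w 1 + (v 2 * w 5 - v 5 * w 2)) * hε
  upsilon v := by
    have hdet : ((c ^ 2 + d ^ 2) * ε ^ 2 : ℂ) = 1 := by
      norm_cast
      rw [h, hε, one_mul]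
    rw [← one_mul (stdUpsilon v), ← hdet]
    simp [stdUpsilon_eq, zCoord_orth]
    ring

lemma orth_apply_eq_zero_iff (h : c ^ 2 + d ^ 2 = 1) (hε : ε ^ 2 = 1) (v : R6) :
    (orth c d ε v 0 = 0 ∧ orth c d ε v 1 = 0) ↔ v 0 = 0 ∧ v 1 = 0 := by
  change (c * v 0 - ε * d * v 1 = 0 ∧ d * v 0 + ε * c * v 1 = 0) ↔ _
  refine ⟨fun ⟨h₀, h₁⟩ => ⟨?_, ?_⟩, fun ⟨h₀, h₁⟩ => by simp [h₀, h₁]⟩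
  · linear_combination c * h₀ + d * h₁ - v 0 * h
  · linear_combination -ε * d * h₀ + ε * c * h₁ - v 1 * ε ^ 2 * h - v 1 * hε

lemma IsO2Coframe.orth_comp {Ω : TwoForm} {Υ : ThreeFormC} {W : R6 → Submodule ℝ R6} {y : R6}
    {f : R6 →L[ℝ] R6} (hf : IsO2Coframe Ω Υ W y f) (h : c ^ 2 + d ^ 2 = 1) (hε : ε ^ 2 = 1) :
    IsO2Coframe Ω Υ W y (orth c d ε ∘L f) := by
  obtain ⟨⟨hb, hΩ, hΥ⟩, hW⟩ := hf
  have hA := orth_preservesSU3 h hε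
  exact ⟨⟨hA.bijective.comp hb, fun v => (hΩ v).trans (hA.omega _ _).symm,
    fun v => (hΥ v).trans (hA.upsilon _).symm⟩,
    fun v => (hW v).trans (orth_apply_eq_zero_iff h hε _).symm⟩

namespace PreservesSU3

lemma eq_orth_of_apply_single {A : R6 →L[ℝ] R6} (hA : PreservesSU3 A) {c d m n p q : ℝ}
    (hpq : p ^ 2 + q ^ 2 = 1) (he₀ : A (EuclideanSpace.single 0 1) = !₂[c, d, 0, 0, 0, 0])
    (he₁ : A (EuclideanSpace.single 1 1) = !₂[m, n, 0, 0, 0, 0])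
    (he₂ : A (EuclideanSpace.single 2 1) = !₂[0, 0, p, 0, 0, q]) :
    c ^ 2 + d ^ 2 = 1 ∧ (c * n - d * m) ^ 2 = 1 ∧ A = orth c d (c * n - d * m) := by
  have hcd : c ^ 2 + d ^ 2 = 1 := by
    have hinner := hA.inner_map_map (EuclideanSpace.single 0 1) (EuclideanSpace.single 0 1)
    rw [he₀, inner_eq, inner_eq] at hinner
    simpa [← sq] using hinner
  have hmn : c * m + d * n = 0 := by
    have hinner := hA.inner_map_map (EuclideanSpace.single 0 1) (EuclideanSpace.single 1 1)
    rw [he₀, he₁, inner_eq, inner_eq] at hinner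
    simpa using hinner
  obtain ⟨hp, hq⟩ : (c * n - d * m) * p = 1 ∧ (c * n - d * m) * q = 0 := by
    have hΥ := hA.upsilon
      ![EuclideanSpace.single 0 1, EuclideanSpace.single 1 1, EuclideanSpace.single 2 1]
    simp only [stdUpsilon_eq, Matrix.cons_val, he₀, he₁, he₂] at hΥ
    constructor
    · linear_combination (norm := (simp [zCoord]; ring)) congrArg Complex.re hΥ
    · linear_combination (norm := (simp [zCoord]; ring)) congrArg Complex.im hΥ
  have hε : (c * n - d * m) ^ 2 = 1 := by
    linear_combination (c * n - d * m) * (p * hp + q * hq) + hp - (c * n - d * m) ^ 2 * hpq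
  refine ⟨hcd, hε, hA.ext (orth_preservesSU3 hcd hε) ?_ ?_ ?_⟩
  · refine he₀.trans ?_
    ext i
    fin_cases i <;> simp [orth_apply]
  · refine he₁.trans ?_
    ext i
    fin_cases i <;> simp [orth_apply]
    · linear_combination c * hmn - m * hcd
    · linear_combination d * hmn - n * hcd
  · refine he₂.trans ?_
    ext i
    fin_cases i <;> simp [orth_apply]
    · linear_combination (c * n - d * m) * hp - p * hε
    · linear_combination (c * n - d * m) * hq - q * hε

variable {A : R6 →L[ℝ] R6} (hA : PreservesSU3 A)
  (hW : ∀ v : R6, v 0 = 0 → v 1 = 0 → A v 0 = 0 ∧ A v 1 = 0)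

include hA hW

lemma apply_three_four {v : R6} (h₃ : v 3 = 0) (h₄ : v 4 = 0) : A v 3 = 0 ∧ A v 4 = 0 := by
  have hJ := hW (complexStructure v) (by simpa [complexStructure] using h₃)
    (by simpa [complexStructure] using h₄)
  rw [hA.map_complexStructure] at hJ
  simpa [complexStructure] using hJ

lemma apply_single_two : ∃ p q : ℝ, p ^ 2 + q ^ 2 = 1 ∧
    A (EuclideanSpace.single 2 1) = !₂[0, 0, p, 0, 0, q] := by
  obtain ⟨h₀, h₁⟩ := hW (EuclideanSpace.single 2 1) (by simp) (by simp)
  obtain ⟨h₃, h₄⟩ := hA.apply_three_four hW (v := EuclideanSpace.single 2 1) (by simp) (by simp)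
  have hnorm := hA.inner_map_map (EuclideanSpace.single 2 1) (EuclideanSpace.single 2 1)
  simp only [inner_eq, h₀, h₁, h₃, h₄] at hnorm
  refine ⟨A (EuclideanSpace.single 2 1) 2, A (EuclideanSpace.single 2 1) 5, ?_, ?_⟩
  · simpa [← sq] using hnorm
  · ext i
    fin_cases i <;> simp [h₀, h₁, h₃, h₄]

lemma apply_two_five {v : R6} (h₂ : v 2 = 0) (h₅ : v 5 = 0) : A v 2 = 0 ∧ A v 5 = 0 := by
  obtain ⟨p, q, hpq, he⟩ := hA.apply_single_two hW
  have hinner : A v 2 * p + A v 5 * q = 0 := by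
    simpa [he, inner_eq, h₂] using hA.inner_map_map v (EuclideanSpace.single 2 1)
  have hΩ : A v 2 * q - A v 5 * p = 0 := by
    simpa [he, stdOmega, h₅] using hA.omega v (EuclideanSpace.single 2 1)
  constructor
  · linear_combination p * hinner + q * hΩ - A v 2 * hpq
  · linear_combination q * hinner - p * hΩ - A v 5 * hpq

lemma apply_eq_of_apply_eq_zero {v : R6} (h₂ : v 2 = 0) (h₃ : v 3 = 0) (h₄ : v 4 = 0)
    (h₅ : v 5 = 0) : A v = !₂[A v 0, A v 1, 0, 0, 0, 0] := by
  obtain ⟨k₃, k₄⟩ := hA.apply_three_four hW h₃ h₄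
  obtain ⟨k₂, k₅⟩ := hA.apply_two_five hW h₂ h₅
  ext i
  fin_cases i <;> simp [k₂, k₃, k₄, k₅]

theorem exists_eq_orth : ∃ c d ε : ℝ, c ^ 2 + d ^ 2 = 1 ∧ ε ^ 2 = 1 ∧ A = orth c d ε := by
  obtain ⟨p, q, hpq, he₂⟩ := hA.apply_single_two hW
  have he₀ := hA.apply_eq_of_apply_eq_zero hW (v := EuclideanSpace.single 0 1)
    (by simp) (by simp) (by simp) (by simp)
  have he₁ := hA.apply_eq_of_apply_eq_zero hW (v := EuclideanSpace.single 1 1)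
    (by simp) (by simp) (by simp) (by simp)
  exact ⟨_, _, _, hA.eq_orth_of_apply_single hpq he₀ he₁ he₂⟩

end PreservesSU3

variable {f : R6 →L[ℝ] R6} {df : R6 → R6 → R6} {β : R6 →ₗ[ℝ] ℝ} {a₁ a₂ a₀ : ℝ}

lemma ReducedEquations.orth_comp (H : ReducedEquations f df β a₁ a₂ a₀) (h : c ^ 2 + d ^ 2 = 1)
    (hε : ε ^ 2 = 1) :
    ReducedEquations (orth c d ε ∘L f) (fun v w => orth c d ε (df v w)) (ε • β)
      (c * a₁ - ε * d * a₂) (d * a₁ + ε * c * a₂) a₀ := by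
  have hcases : ε = 1 ∨ ε = -1 := sq_eq_one_iff.1 hε
  refine ⟨fun v w => ?_, fun v w => ?_, fun v w => ?_, fun v w => ?_, fun v w => ?_,
    fun v w => ?_⟩
  all_goals
    simp only [orth_apply, wedgeComp, wedgeConn, ContinuousLinearMap.comp_apply,
      LinearMap.smul_apply, smul_eq_mul, Matrix.cons_val]
  · rcases hcases with rfl | rfl <;> simp only [H.d₁, H.d₂, wedgeConn] <;> ring
  · rcases hcases with rfl | rfl <;> simp only [H.d₁, H.d₂, wedgeConn] <;> ring
  · have hrot : df v w 2 = (c ^ 2 + d ^ 2) * df v w 2 := by rw [h, one_mul]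
    rw [hrot, H.d₃]
    rcases hcases with rfl | rfl <;> simp only [wedgeComp] <;> ring
  · rcases hcases with rfl | rfl <;> simp only [H.d₄, H.d₅, wedgeComp, wedgeConn] <;> ring
  · rcases hcases with rfl | rfl <;> simp only [H.d₄, H.d₅, wedgeComp, wedgeConn] <;> ring
  · have hrot : df v w 5 = (c ^ 2 + d ^ 2) * df v w 5 := by rw [h, one_mul]
    rw [hrot, H.d₆]
    rcases hcases with rfl | rfl <;> simp only [wedgeComp] <;> ring

variable {Ω : TwoForm} {Υ : ThreeFormC} {W : R6 → Submodule ℝ R6} {y : R6}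
  {σ : R6 → R6 →L[ℝ] R6}

lemma ReducedEquations.isAt (hσ : ContDiffAt ℝ ∞ σ y)
    (hO : ∀ᶠ z in 𝓝 y, IsO2Coframe Ω Υ W z (σ z))
    (H : ReducedEquations (σ y) (extDerivOneForm σ y) β a₁ a₂ a₀) :
    (reducedTorsion a₁ a₂ a₀).IsAt Ω Υ W y (σ y) :=
  ⟨σ, hσ, hO, rfl, H.structureEquations⟩

theorem isTypeIIIWithUZero_of_reducedEquations {U : Set R6} (hU : IsOpen U)
    (hσ : ContDiffOn ℝ ∞ σ U) (hO : ∀ y ∈ U, IsO2Coframe Ω Υ W y (σ y))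
    (H : ∀ y ∈ U, ∃ β a₁ a₂ a₀, ReducedEquations (σ y) (extDerivOneForm σ y) β a₁ a₂ a₀) :
    IsTypeIIIWithUZero U Ω Υ W := by
  intro y hy f hf
  obtain ⟨β, a₁, a₂, a₀, he⟩ := H y hy
  obtain ⟨A, hA, rfl⟩ := (hO y hy).1.exists_preservesSU3_comp hf.1
  have hσy : ContDiffAt ℝ ∞ σ y := hσ.contDiffAt (hU.mem_nhds hy)
  obtain ⟨c, d, ε, h, hε, rfl⟩ := hA.exists_eq_orth fun v h₀ h₁ => by
    obtain ⟨v, rfl⟩ := (hO y hy).1.1.2 v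
    exact (hf.2 v).1 (((hO y hy).2 v).2 ⟨h₀, h₁⟩)
  have hsection : ∀ᶠ z in 𝓝 y, IsO2Coframe Ω Υ W z (orth c d ε ∘L σ z) := by
    filter_upwards [hU.mem_nhds hy] with z hz using (hO z hz).orth_comp h hε
  have hd : extDerivOneForm (fun z => orth c d ε ∘L σ z) y =
      fun v w => orth c d ε (extDerivOneForm σ y v w) :=
    funext₂ (extDerivOneForm_clm_comp _ (hσy.differentiableAt (by simp)))
  exact ⟨_, _, (hd ▸ he.orth_comp h hε).isAt (σ := fun z => orth c d ε ∘L σ z)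
    (contDiffAt_const.clm_comp hσy) hsection,
    reducedTorsion_isTypeIII _ _ _, reducedInvariants_of _ _ _, rfl⟩

end O2

section Profile

/-- The values of the squared radius `N` of the orbit surface at which the square roots below have
positive radicands; it is an open set containing `[0, ∞)`. -/
def profileDomain (s : ℝ) : Set ℝ := {N | 0 < 1 + 3 * N} ∩ {N | 0 < 1 + s ^ 2 * N}

/-- The first of the two square roots occurring in the profile functions. -/
def radialRoot (N : ℝ) : ℝ := √(1 + 3 * N)

/-- The second square root occurring in the profile functions; the parameter `s` is the value of
the invariant `a₀` at `N = 0`. -/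
def torsionRoot (s N : ℝ) : ℝ := √(1 + s ^ 2 * N)

/-- The length factor of the orbit surface in the tangential direction. -/
def tangentialScale (s N : ℝ) : ℝ := 1 / (radialRoot N * torsionRoot s N)

/-- The function `k` for which `tangentialScale + N * k` is the length factor of the orbit surface
in the radial direction. -/
def radialExcess (s N : ℝ) : ℝ :=
  (s ^ 2 - 3) / (radialRoot N ^ 2 * torsionRoot s N * (radialRoot N + torsionRoot s N))

/-- The coefficient of `X dY - Y dX` in the connection form of the orbit surface. -/
def connectionCoeff (s N : ℝ) : ℝ :=
  radialRoot N ^ 2 * radialExcess s N +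
    tangentialScale s N * (3 + s ^ 2 * radialRoot N ^ 2 / torsionRoot s N ^ 2)

/-- The coefficient of `X + iY` in the invariant `a₁ + i a₂`. -/
def vectorCoeff (s N : ℝ) : ℝ := (s ^ 2 - 3) / torsionRoot s N ^ 2

/-- The invariant `a₀` as a function of `N`. -/
def scalarInvariant (s N : ℝ) : ℝ := s * radialRoot N ^ 2 / torsionRoot s N ^ 2

/-- The length factor of `ω⁶`. -/
def fibreScale (s N : ℝ) : ℝ := torsionRoot s N / radialRoot N

/-- The coefficient of `X dY - Y dX` in `ω⁶ / fibreScale`. -/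
def fibreCoeff (s N : ℝ) : ℝ := -s / torsionRoot s N ^ 2

variable {s N : ℝ}

lemma mem_profileDomain_of_nonneg (s : ℝ) (hN : 0 ≤ N) : N ∈ profileDomain s :=
  ⟨show 0 < 1 + 3 * N by positivity, show 0 < 1 + s ^ 2 * N by positivity⟩

lemma isOpen_profileDomain (s : ℝ) : IsOpen (profileDomain s) :=
  (isOpen_lt continuous_const (by fun_prop)).inter (isOpen_lt continuous_const (by fun_prop))

lemma radialRoot_pos (hN : N ∈ profileDomain s) : 0 < radialRoot N := Real.sqrt_pos.2 hN.1

lemma torsionRoot_pos (hN : N ∈ profileDomain s) : 0 < torsionRoot s N := Real.sqrt_pos.2 hN.2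

lemma sq_radialRoot (hN : N ∈ profileDomain s) : radialRoot N ^ 2 = 1 + 3 * N :=
  Real.sq_sqrt hN.1.le

lemma sq_torsionRoot (hN : N ∈ profileDomain s) : torsionRoot s N ^ 2 = 1 + s ^ 2 * N :=
  Real.sq_sqrt hN.2.le

lemma tangentialScale_pos (hN : N ∈ profileDomain s) : 0 < tangentialScale s N :=
  one_div_pos.2 (mul_pos (radialRoot_pos hN) (torsionRoot_pos hN))

lemma fibreScale_pos (hN : N ∈ profileDomain s) : 0 < fibreScale s N :=
  div_pos (torsionRoot_pos hN) (radialRoot_pos hN)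

lemma contDiffAt_radialRoot (hN : N ∈ profileDomain s) : ContDiffAt ℝ ∞ radialRoot N :=
  (contDiffAt_const.add (contDiffAt_const.mul contDiffAt_id)).sqrt hN.1.ne'

lemma contDiffAt_torsionRoot (hN : N ∈ profileDomain s) : ContDiffAt ℝ ∞ (torsionRoot s) N :=
  (contDiffAt_const.add (contDiffAt_const.mul contDiffAt_id)).sqrt hN.2.ne'

lemma contDiffAt_tangentialScale (hN : N ∈ profileDomain s) :
    ContDiffAt ℝ ∞ (tangentialScale s) N :=
  contDiffAt_const.div ((contDiffAt_radialRoot hN).mul (contDiffAt_torsionRoot hN))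
    (mul_pos (radialRoot_pos hN) (torsionRoot_pos hN)).ne'

lemma contDiffAt_radialExcess (hN : N ∈ profileDomain s) : ContDiffAt ℝ ∞ (radialExcess s) N := by
  have hu := radialRoot_pos hN
  have ht := torsionRoot_pos hN
  have hu' := contDiffAt_radialRoot hN
  have ht' := contDiffAt_torsionRoot hN
  exact contDiffAt_const.div (((hu'.pow 2).mul ht').mul (hu'.add ht')) (by positivity)

lemma contDiffAt_scalarInvariant (hN : N ∈ profileDomain s) :
    ContDiffAt ℝ ∞ (scalarInvariant s) N :=
  (contDiffAt_const.mul ((contDiffAt_radialRoot hN).pow 2)).div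
    ((contDiffAt_torsionRoot hN).pow 2) (pow_pos (torsionRoot_pos hN) 2).ne'

lemma contDiffAt_connectionCoeff (hN : N ∈ profileDomain s) :
    ContDiffAt ℝ ∞ (connectionCoeff s) N := by
  have hu' := contDiffAt_radialRoot hN
  have ht' := contDiffAt_torsionRoot hN
  exact ((hu'.pow 2).mul (contDiffAt_radialExcess hN)).add ((contDiffAt_tangentialScale hN).mul
    (contDiffAt_const.add ((contDiffAt_const.mul (hu'.pow 2)).div (ht'.pow 2)
      (pow_pos (torsionRoot_pos hN) 2).ne')))

lemma contDiffAt_vectorCoeff (hN : N ∈ profileDomain s) : ContDiffAt ℝ ∞ (vectorCoeff s) N :=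
  contDiffAt_const.div ((contDiffAt_torsionRoot hN).pow 2) (pow_pos (torsionRoot_pos hN) 2).ne'

lemma contDiffAt_fibreScale (hN : N ∈ profileDomain s) : ContDiffAt ℝ ∞ (fibreScale s) N :=
  (contDiffAt_torsionRoot hN).div (contDiffAt_radialRoot hN) (radialRoot_pos hN).ne'

lemma contDiffAt_fibreCoeff (hN : N ∈ profileDomain s) : ContDiffAt ℝ ∞ (fibreCoeff s) N :=
  contDiffAt_const.div ((contDiffAt_torsionRoot hN).pow 2) (pow_pos (torsionRoot_pos hN) 2).ne'

lemma radialScale_eq (hN : N ∈ profileDomain s) :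
    tangentialScale s N + N * radialExcess s N = 1 / radialRoot N ^ 2 := by
  have hu := radialRoot_pos hN
  have ht := torsionRoot_pos hN
  unfold tangentialScale radialExcess
  field_simp
  linear_combination sq_radialRoot hN - sq_torsionRoot hN

lemma mul_connectionCoeff (hN : N ∈ profileDomain s) : N * connectionCoeff s N =
    1 - tangentialScale s N * (1 - s ^ 2 * N * (1 + 3 * N) / (1 + s ^ 2 * N)) := by
  have hk : N * radialExcess s N = 1 / radialRoot N ^ 2 - tangentialScale s N := by
    linear_combination radialScale_eq hN
  have hu := radialRoot_pos hN
  calc N * connectionCoeff s N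
      = radialRoot N ^ 2 * (N * radialExcess s N) + N * tangentialScale s N *
          (3 + s ^ 2 * radialRoot N ^ 2 / torsionRoot s N ^ 2) := by unfold connectionCoeff; ring
    _ = 1 - radialRoot N ^ 2 * tangentialScale s N + N * tangentialScale s N *
          (3 + s ^ 2 * radialRoot N ^ 2 / torsionRoot s N ^ 2) := by rw [hk]; field_simp
    _ = _ := by rw [sq_radialRoot hN, sq_torsionRoot hN]; field_simp; ring

lemma vectorCoeff_eq (hN : N ∈ profileDomain s) : vectorCoeff s N =
    vectorCoeff s N * connectionCoeff s N * N +
      (scalarInvariant s N ^ 2 - 3) * tangentialScale s N := by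
  have ht : 0 < 1 + s ^ 2 * N := hN.2
  rw [mul_assoc, mul_comm (connectionCoeff s N), mul_connectionCoeff hN]
  unfold vectorCoeff scalarInvariant
  rw [sq_radialRoot hN, sq_torsionRoot hN]
  field_simp
  ring

lemma hasDerivAt_radialRoot (hN : N ∈ profileDomain s) :
    HasDerivAt radialRoot (3 / (2 * radialRoot N)) N := by
  have h := (((hasDerivAt_id N).const_mul 3).const_add 1).sqrt hN.1.ne'
  rwa [mul_one] at h

lemma hasDerivAt_torsionRoot (hN : N ∈ profileDomain s) :
    HasDerivAt (torsionRoot s) (s ^ 2 / (2 * torsionRoot s N)) N := by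
  have h := (((hasDerivAt_id N).const_mul (s ^ 2)).const_add 1).sqrt hN.2.ne'
  rwa [mul_one] at h

lemma hasDerivAt_inv_sq_torsionRoot (hN : N ∈ profileDomain s) :
    HasDerivAt (fun N => (torsionRoot s N ^ 2)⁻¹) (-s ^ 2 / torsionRoot s N ^ 4) N := by
  have ht := torsionRoot_pos hN
  refine (((hasDerivAt_torsionRoot hN).fun_pow 2).fun_inv (pow_pos ht 2).ne').congr_deriv ?_
  rw [pow_one, Nat.cast_ofNat]
  field_simp

lemma hasDerivAt_tangentialScale (hN : N ∈ profileDomain s) :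
    HasDerivAt (tangentialScale s)
      ((radialExcess s N - connectionCoeff s N / radialRoot N ^ 2) / 2) N := by
  have hu := radialRoot_pos hN
  have ht := torsionRoot_pos hN
  have h := ((hasDerivAt_radialRoot hN).fun_mul (hasDerivAt_torsionRoot hN)).fun_inv
    (mul_pos hu ht).ne'
  simp only [← one_div] at h
  refine h.congr_deriv ?_
  unfold connectionCoeff tangentialScale
  field_simp
  ring

lemma hasDerivAt_scalarInvariant (hN : N ∈ profileDomain s) :
    HasDerivAt (scalarInvariant s)
      (-scalarInvariant s N * vectorCoeff s N / radialRoot N ^ 2) N := by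
  have hu := radialRoot_pos hN
  have ht := torsionRoot_pos hN
  have h := (((hasDerivAt_radialRoot hN).fun_pow 2).const_mul s).fun_div
    ((hasDerivAt_torsionRoot hN).fun_pow 2) (pow_pos ht 2).ne'
  refine h.congr_deriv ?_
  unfold scalarInvariant vectorCoeff
  rw [pow_one, pow_one, Nat.cast_ofNat]
  field_simp
  linear_combination s * 3 * sq_torsionRoot hN - s * s ^ 2 * sq_radialRoot hN

lemma hasDerivAt_fibreScale (hN : N ∈ profileDomain s) :
    HasDerivAt (fibreScale s) (fibreScale s N * vectorCoeff s N / radialRoot N ^ 2 / 2) N := by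
  have hu := radialRoot_pos hN
  have ht := torsionRoot_pos hN
  refine ((hasDerivAt_torsionRoot hN).fun_div (hasDerivAt_radialRoot hN) hu.ne').congr_deriv ?_
  unfold fibreScale vectorCoeff
  field_simp
  linear_combination s ^ 2 * sq_radialRoot hN - 3 * sq_torsionRoot hN

lemma hasDerivAt_vectorCoeff (hN : N ∈ profileDomain s) :
    HasDerivAt (vectorCoeff s) ((-vectorCoeff s N * connectionCoeff s N +
      (scalarInvariant s N ^ 2 - 3) * radialExcess s N -
      vectorCoeff s N ^ 2 / radialRoot N ^ 2) / 2) N := by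
  have hu := radialRoot_pos hN
  have ht := torsionRoot_pos hN
  have h1 := sq_radialRoot hN
  have h2 := sq_torsionRoot hN
  refine ((hasDerivAt_inv_sq_torsionRoot hN).const_mul (s ^ 2 - 3)).congr_deriv ?_
  unfold vectorCoeff scalarInvariant connectionCoeff tangentialScale radialExcess
  generalize radialRoot N = u at *
  generalize torsionRoot s N = t at *
  field_simp
  linear_combination -(s ^ 2 - 3) * t * (u + t) * (s ^ 2 * h1 - 3 * h2)

lemma hasDerivAt_fibreCoeff (hN : N ∈ profileDomain s) :
    HasDerivAt (fibreCoeff s) (s ^ 3 / torsionRoot s N ^ 4) N := by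
  have h := (hasDerivAt_inv_sq_torsionRoot hN).const_mul (-s)
  simp only [← div_eq_mul_inv] at h
  exact h.congr_deriv (by ring)

lemma deriv_fibreCoeff_mul_add (hN : N ∈ profileDomain s) :
    deriv (fibreCoeff s) N * N + fibreCoeff s N =
      -(scalarInvariant s N / fibreScale s N) * tangentialScale s N / radialRoot N ^ 2 := by
  have hu := radialRoot_pos hN
  have ht := torsionRoot_pos hN
  rw [(hasDerivAt_fibreCoeff hN).deriv]
  unfold fibreCoeff scalarInvariant fibreScale tangentialScale
  field_simp
  linear_combination -s * sq_torsionRoot hN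

lemma hasDerivAt_mul_connectionCoeff (hN : N ∈ profileDomain s) :
    HasDerivAt (fun N => N * connectionCoeff s N)
      (3 / 2 * (1 + scalarInvariant s N ^ 2) * tangentialScale s N / radialRoot N ^ 2) N := by
  have hu : 0 < 1 + 3 * N := hN.1
  have ht : 0 < 1 + s ^ 2 * N := hN.2
  have hid := hasDerivAt_id' N
  have hg : HasDerivAt (tangentialScale s)
      (-(3 / radialRoot N ^ 2 + s ^ 2 / torsionRoot s N ^ 2) * tangentialScale s N / 2) N := by
    have hu := radialRoot_pos hN
    have ht := torsionRoot_pos hN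
    refine (hasDerivAt_tangentialScale hN).congr_deriv ?_
    unfold connectionCoeff
    field_simp
    ring
  have hquot := ((hid.const_mul (s ^ 2)).fun_mul ((hid.const_mul 3).const_add 1)).fun_div
    ((hid.const_mul (s ^ 2)).const_add 1) ht.ne'
  have h := ((hg.fun_mul (hquot.const_sub 1)).const_sub 1).congr_of_eventuallyEq
    (Filter.eventually_of_mem ((isOpen_profileDomain s).mem_nhds hN) fun _ => mul_connectionCoeff)
  refine h.congr_deriv ?_
  unfold scalarInvariant
  rw [sq_radialRoot hN, sq_torsionRoot hN]
  generalize tangentialScale s N = g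
  have ht' : 1 + N * s ^ 2 ≠ 0 := by rw [mul_comm]; exact ht.ne'
  field_simp
  ring

lemma deriv_connectionCoeff_mul_add (hN : N ∈ profileDomain s) :
    deriv (connectionCoeff s) N * N + connectionCoeff s N =
      3 / 2 * (1 + scalarInvariant s N ^ 2) * tangentialScale s N / radialRoot N ^ 2 := by
  have hc := ((contDiffAt_connectionCoeff hN).differentiableAt (by simp)).hasDerivAt
  have h := (hasDerivAt_id' N).fun_mul hc
  linear_combination h.unique (hasDerivAt_mul_connectionCoeff hN)

end Profile

section ExteriorCalculus

variable {E E' F F' G A : Type*} [NormedAddCommGroup E] [NormedSpace ℝ E]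
  [NormedAddCommGroup E'] [NormedSpace ℝ E'] [NormedAddCommGroup F] [NormedSpace ℝ F]
  [NormedAddCommGroup F'] [NormedSpace ℝ F'] [NormedAddCommGroup G] [NormedSpace ℝ G]
  [NormedDivisionRing A] [NormedAlgebra ℝ A]

/-- The vector-valued one-form `φ` is differentiable at `y` and `B` is its exterior derivative
there. -/
def HasExtDerivAt (φ : E → E →L[ℝ] F) (B : E → E → F) (y : E) : Prop :=
  DifferentiableAt ℝ φ y ∧ ∀ v w, extDerivOneForm φ y v w = B v w

variable {φ ψ : E → E →L[ℝ] F} {B C : E → E → F} {y : E}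

lemma HasExtDerivAt.congr (h : HasExtDerivAt φ B y) (hBC : ∀ v w, B v w = C v w) :
    HasExtDerivAt φ C y :=
  ⟨h.1, fun v w => (h.2 v w).trans (hBC v w)⟩

lemma hasExtDerivAt_of_hasFDerivAt {φ' : E →L[ℝ] E →L[ℝ] F} (h : HasFDerivAt φ φ' y) :
    HasExtDerivAt φ (fun v w => φ' v w - φ' w v) y :=
  ⟨h.differentiableAt, fun v w => by rw [extDerivOneForm, h.fderiv]⟩

lemma hasExtDerivAt_const (L : E →L[ℝ] F) : HasExtDerivAt (fun _ => L) (fun _ _ => 0) y :=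
  (hasExtDerivAt_of_hasFDerivAt (hasFDerivAt_const L y)).congr fun _ _ => sub_self _

lemma HasExtDerivAt.add (h : HasExtDerivAt φ B y) (h' : HasExtDerivAt ψ C y) :
    HasExtDerivAt (fun z => φ z + ψ z) (fun v w => B v w + C v w) y := by
  refine (hasExtDerivAt_of_hasFDerivAt (h.1.hasFDerivAt.add h'.1.hasFDerivAt)).congr fun v w => ?_
  rw [← h.2, ← h'.2]
  exact add_sub_add_comm _ _ _ _

lemma HasExtDerivAt.clm_comp (L : F →L[ℝ] F') (h : HasExtDerivAt φ B y) :
    HasExtDerivAt (fun z => L ∘L φ z) (fun v w => L (B v w)) y :=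
  ⟨(ContinuousLinearMap.compL ℝ E F F' L).differentiableAt.comp y h.1, fun v w => by
    rw [extDerivOneForm_clm_comp L h.1, h.2]⟩

lemma HasExtDerivAt.pullback {φ : E' → E' →L[ℝ] F} {B : E' → E' → F} {f : E → E'}
    {T : E →L[ℝ] E'} (hf : ∀ z, HasFDerivAt f T z) (h : HasExtDerivAt φ B (f y)) :
    HasExtDerivAt (fun z => φ (f z) ∘L T) (fun v w => B (T v) (T w)) y := by
  have hφ : HasFDerivAt (fun z => φ (f z) ∘L T) _ y :=
    ((ContinuousLinearMap.compL ℝ E E' F).flip T).hasFDerivAt.comp y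
      (h.1.hasFDerivAt.comp y (hf y))
  exact (hasExtDerivAt_of_hasFDerivAt hφ).congr fun v w => h.2 (T v) (T w)

lemma HasExtDerivAt.bilinear_comp (b : G →L[ℝ] F →L[ℝ] F') {c : E → G} {c' : E →L[ℝ] G}
    (h : HasExtDerivAt φ B y) (hc : HasFDerivAt c c' y) :
    HasExtDerivAt (fun z => b (c z) ∘L φ z)
      (fun v w => b (c' v) (φ y w) - b (c' w) (φ y v) + b (c y) (B v w)) y := by
  refine (hasExtDerivAt_of_hasFDerivAt
    ((b.hasFDerivAt.comp y hc).clm_comp h.1.hasFDerivAt)).congr fun v w => ?_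
  rw [← h.2, extDerivOneForm, map_sub]
  change b (c y) (fderiv ℝ φ y v w) + b (c' v) (φ y w) -
    (b (c y) (fderiv ℝ φ y w v) + b (c' w) (φ y v)) = _
  abel

lemma HasExtDerivAt.smul {c : E → ℝ} {c' : E →L[ℝ] ℝ} (h : HasExtDerivAt φ B y)
    (hc : HasFDerivAt c c' y) :
    HasExtDerivAt (fun z => c z • φ z)
      (fun v w => c' v • φ y w - c' w • φ y v + c y • B v w) y :=
  h.bilinear_comp (ContinuousLinearMap.lsmul ℝ ℝ) hc

lemma HasExtDerivAt.smulRight {φ : E → E →L[ℝ] ℝ} {B : E → E → ℝ} {c : E → F} {c' : E →L[ℝ] F}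
    (h : HasExtDerivAt φ B y) (hc : HasFDerivAt c c' y) :
    HasExtDerivAt (fun z => (φ z).smulRight (c z))
      (fun v w => φ y w • c' v - φ y v • c' w + B v w • c y) y :=
  h.bilinear_comp (ContinuousLinearMap.lsmul ℝ ℝ).flip hc

/-- The Maurer–Cartan form `g⁻¹ dg` of the group of units of a normed division algebra. -/
def maurerCartanForm (g : A) : A →L[ℝ] A := ContinuousLinearMap.mul ℝ A g⁻¹

lemma hasExtDerivAt_maurerCartanForm {g : A} (hg : g ≠ 0) :
    HasExtDerivAt (maurerCartanForm (A := A)) (fun v w =>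
      -(maurerCartanForm g v * maurerCartanForm g w -
        maurerCartanForm g w * maurerCartanForm g v)) g := by
  refine ((hasExtDerivAt_const (.id ℝ A)).bilinear_comp (ContinuousLinearMap.mul ℝ A)
    (hasFDerivAt_inv' (𝕜 := ℝ) hg)).congr fun v w => ?_
  change -(g⁻¹ * v * g⁻¹) * w - -(g⁻¹ * w * g⁻¹) * v + g⁻¹ * 0 =
    -(g⁻¹ * v * (g⁻¹ * w) - g⁻¹ * w * (g⁻¹ * v))
  noncomm_ring

end ExteriorCalculus

section OrbitSurface

open ComplexConjugate

variable (s : ℝ) {ζ : ℂ}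

/-- The one-form `X dX + Y dY` on the plane of `ζ = X + iY`. -/
def radialForm (ζ : ℂ) : ℂ →L[ℝ] ℝ := reCLM ∘L ContinuousLinearMap.mul ℝ ℂ (conj ζ)

/-- The one-form `X dY - Y dX` on the plane of `ζ = X + iY`. -/
def rotationForm (ζ : ℂ) : ℂ →L[ℝ] ℝ := imCLM ∘L ContinuousLinearMap.mul ℝ ℂ (conj ζ)

/-- The area form of the plane. -/
def areaForm (v w : ℂ) : ℝ := v.re * w.im - w.re * v.im

/-- The coframe `η = ω¹ + i ω²` of the orbit surface. -/
def surfaceForm (ζ : ℂ) : ℂ →L[ℝ] ℂ :=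
  tangentialScale s (normSq ζ) • .id ℝ ℂ +
    radialExcess s (normSq ζ) • (radialForm ζ).smulRight ζ

/-- The connection form `β` of the orbit surface. -/
def surfaceConnection (ζ : ℂ) : ℂ →L[ℝ] ℝ := connectionCoeff s (normSq ζ) • rotationForm ζ

/-- The invariant `a = a₁ + i a₂` on the orbit surface. -/
def surfaceVector (ζ : ℂ) : ℂ := vectorCoeff s (normSq ζ) • ζ

/-- The invariant `a₀` on the orbit surface. -/
def surfaceScalar (ζ : ℂ) : ℝ := scalarInvariant s (normSq ζ)

lemma radialForm_apply (ζ w : ℂ) : radialForm ζ w = ζ.re * w.re + ζ.im * w.im := by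
  change (conj ζ * w).re = _
  rw [mul_re, conj_re, conj_im]
  ring

lemma rotationForm_apply (ζ w : ℂ) : rotationForm ζ w = ζ.re * w.im - ζ.im * w.re := by
  change (conj ζ * w).im = _
  rw [mul_im, conj_re, conj_im]
  ring

variable {s}

lemma surfaceForm_apply (ζ w : ℂ) : surfaceForm s ζ w = tangentialScale s (normSq ζ) • w +
    radialExcess s (normSq ζ) • radialForm ζ w • ζ :=
  rfl

lemma surfaceConnection_apply (ζ w : ℂ) :
    surfaceConnection s ζ w = connectionCoeff s (normSq ζ) * rotationForm ζ w :=
  rfl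

lemma normSq_mem_profileDomain : normSq ζ ∈ profileDomain s :=
  mem_profileDomain_of_nonneg s (normSq_nonneg ζ)

lemma hasFDerivAt_comp_normSq {f : ℝ → ℝ} {f' : ℝ} (hf : HasDerivAt f f' (normSq ζ)) :
    HasFDerivAt (fun z => f (normSq z)) ((2 * f') • radialForm ζ) ζ := by
  have h := (reCLM.hasFDerivAt (x := ζ)).fun_mul reCLM.hasFDerivAt
    |>.fun_add (imCLM.hasFDerivAt.fun_mul imCLM.hasFDerivAt)
  refine (hf.comp_hasFDerivAt ζ h).congr_fderiv (ContinuousLinearMap.ext fun w => ?_)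
  change f' * (ζ.re * w.re + ζ.re * w.re + (ζ.im * w.im + ζ.im * w.im)) = 2 * f' * radialForm ζ w
  rw [radialForm_apply]
  ring

lemma hasExtDerivAt_conj_mul : HasExtDerivAt (fun z : ℂ => ContinuousLinearMap.mul ℝ ℂ (conj z))
    (fun v w => conj v * w - conj w * v) ζ :=
  hasExtDerivAt_of_hasFDerivAt
    ((ContinuousLinearMap.mul ℝ ℂ).hasFDerivAt.comp ζ conjCLE.hasFDerivAt)

lemma hasExtDerivAt_radialForm : HasExtDerivAt radialForm (fun _ _ => 0) ζ :=
  (hasExtDerivAt_conj_mul.clm_comp reCLM).congr fun v w => by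
    simp only [reCLM_apply, sub_re, mul_re, conj_re, conj_im]
    ring

lemma hasExtDerivAt_rotationForm :
    HasExtDerivAt rotationForm (fun v w => 2 * areaForm v w) ζ :=
  (hasExtDerivAt_conj_mul.clm_comp imCLM).congr fun v w => by
    simp only [imCLM_apply, sub_im, mul_im, conj_re, conj_im, areaForm]
    ring

lemma hasExtDerivAt_comp_normSq_smul_rotationForm {f : ℝ → ℝ}
    (hf : DifferentiableAt ℝ f (normSq ζ)) :
    HasExtDerivAt (fun z => f (normSq z) • rotationForm z)
      (fun v w => 2 * (deriv f (normSq ζ) * normSq ζ + f (normSq ζ)) * areaForm v w) ζ := by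
  refine (hasExtDerivAt_rotationForm.smul (hasFDerivAt_comp_normSq hf.hasDerivAt)).congr
    fun v w => ?_
  simp only [smul_apply, smul_eq_mul, radialForm_apply, rotationForm_apply, areaForm,
    normSq_apply]
  ring

lemma hasExtDerivAt_surfaceForm :
    HasExtDerivAt (surfaceForm s) (fun v w => I * (surfaceConnection s ζ v * surfaceForm s ζ w -
      surfaceConnection s ζ w * surfaceForm s ζ v)) ζ := by
  have hN : normSq ζ ∈ profileDomain s := normSq_mem_profileDomain
  have hg := hasFDerivAt_comp_normSq (hasDerivAt_tangentialScale hN)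
  have hk := hasFDerivAt_comp_normSq
    ((contDiffAt_radialExcess hN).differentiableAt (by simp)).hasDerivAt
  refine (((hasExtDerivAt_const (.id ℝ ℂ)).smul hg).add
    ((hasExtDerivAt_radialForm.smulRight (hasFDerivAt_id ζ)).smul hk)).congr fun v w => ?_
  have hs := radialScale_eq hN
  have hnorm := normSq_apply ζ
  apply Complex.ext <;>
    simp only [surfaceForm_apply, surfaceConnection_apply, radialForm_apply, rotationForm_apply,
      smul_apply, ContinuousLinearMap.id_apply, ContinuousLinearMap.smulRight_apply, id_eq,
      add_re, add_im, sub_re, sub_im, mul_re, mul_im, smul_re, smul_im, I_re, I_im, ofReal_re,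
      ofReal_im, zero_re, zero_im, smul_eq_mul]
  · linear_combination connectionCoeff s (normSq ζ) * ζ.im * (v.re * w.im - w.re * v.im) *
      (radialExcess s (normSq ζ) * hnorm - hs)
  · linear_combination connectionCoeff s (normSq ζ) * ζ.re * (v.re * w.im - w.re * v.im) *
      (hs - radialExcess s (normSq ζ) * hnorm)

lemma areaForm_surfaceForm (v w : ℂ) : areaForm (surfaceForm s ζ v) (surfaceForm s ζ w) =
    tangentialScale s (normSq ζ) / radialRoot (normSq ζ) ^ 2 * areaForm v w := by
  have hs := radialScale_eq (s := s) (normSq_mem_profileDomain (ζ := ζ))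
  have hN := normSq_apply ζ
  simp only [areaForm, surfaceForm_apply, radialForm_apply, add_re, add_im, smul_re, smul_im,
    smul_eq_mul]
  linear_combination tangentialScale s (normSq ζ) * (v.re * w.im - w.re * v.im) * hs -
    tangentialScale s (normSq ζ) * radialExcess s (normSq ζ) * (v.re * w.im - w.re * v.im) * hN

lemma hasExtDerivAt_surfaceConnection : HasExtDerivAt (surfaceConnection s) (fun v w =>
    3 * (1 + surfaceScalar s ζ ^ 2) * areaForm (surfaceForm s ζ v) (surfaceForm s ζ w)) ζ := by
  have hN : normSq ζ ∈ profileDomain s := normSq_mem_profileDomain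
  refine (hasExtDerivAt_comp_normSq_smul_rotationForm
    ((contDiffAt_connectionCoeff hN).differentiableAt (by simp))).congr fun v w => ?_
  rw [deriv_connectionCoeff_mul_add hN, areaForm_surfaceForm, surfaceScalar]
  ring

lemma radialForm_surfaceForm (w : ℂ) :
    radialForm ζ (surfaceForm s ζ w) = 1 / radialRoot (normSq ζ) ^ 2 * radialForm ζ w := by
  have hs := radialScale_eq (s := s) (normSq_mem_profileDomain (ζ := ζ))
  have hN := normSq_apply ζ
  simp only [surfaceForm_apply, radialForm_apply, add_re, add_im, smul_re, smul_im, smul_eq_mul]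
  linear_combination (ζ.re * w.re + ζ.im * w.im) * (hs - radialExcess s (normSq ζ) * hN)

lemma radialForm_surfaceVector_surfaceForm (w : ℂ) :
    radialForm (surfaceVector s ζ) (surfaceForm s ζ w) =
      vectorCoeff s (normSq ζ) / radialRoot (normSq ζ) ^ 2 * radialForm ζ w := by
  have h : radialForm (surfaceVector s ζ) (surfaceForm s ζ w) =
      vectorCoeff s (normSq ζ) * radialForm ζ (surfaceForm s ζ w) := by
    simp only [surfaceVector, radialForm_apply, smul_re, smul_im, smul_eq_mul]
    ring
  rw [h, radialForm_surfaceForm]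
  ring

lemma hasFDerivAt_surfaceScalar : HasFDerivAt (surfaceScalar s)
    ((-2 * surfaceScalar s ζ) • radialForm (surfaceVector s ζ) ∘L surfaceForm s ζ) ζ := by
  have hN : normSq ζ ∈ profileDomain s := normSq_mem_profileDomain
  refine (hasFDerivAt_comp_normSq (hasDerivAt_scalarInvariant hN)).congr_fderiv
    (ContinuousLinearMap.ext fun w => ?_)
  simp only [smul_apply, ContinuousLinearMap.comp_apply, smul_eq_mul,
    radialForm_surfaceVector_surfaceForm, surfaceScalar]
  ring

lemma hasFDerivAt_surfaceVector : HasFDerivAt (surfaceVector s)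
    ((surfaceConnection s ζ).smulRight (I * surfaceVector s ζ) +
      (surfaceScalar s ζ ^ 2 - 3) • surfaceForm s ζ -
      (radialForm (surfaceVector s ζ) ∘L surfaceForm s ζ).smulRight (surfaceVector s ζ)) ζ := by
  have hN : normSq ζ ∈ profileDomain s := normSq_mem_profileDomain
  refine ((hasFDerivAt_comp_normSq (hasDerivAt_vectorCoeff hN)).smul
    (hasFDerivAt_id ζ)).congr_fderiv (ContinuousLinearMap.ext fun w => ?_)
  have hh := vectorCoeff_eq hN
  have hnorm := normSq_apply ζ
  simp only [add_apply, sub_apply, smul_apply, ContinuousLinearMap.smulRight_apply,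
    ContinuousLinearMap.comp_apply, radialForm_surfaceVector_surfaceForm]
  apply Complex.ext <;>
    simp only [surfaceVector, surfaceScalar, surfaceForm_apply, surfaceConnection_apply,
      rotationForm_apply, radialForm_apply, ContinuousLinearMap.id_apply, id_eq, add_re, add_im,
      sub_re, sub_im, mul_re, mul_im, smul_re, smul_im, I_re, I_im, smul_eq_mul]
  · linear_combination w.re * hh +
      vectorCoeff s (normSq ζ) * connectionCoeff s (normSq ζ) * w.re * hnorm
  · linear_combination w.im * hh +
      vectorCoeff s (normSq ζ) * connectionCoeff s (normSq ζ) * w.im * hnorm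

lemma contDiff_comp_normSq {f : ℝ → ℝ} (hf : ∀ N ∈ profileDomain s, ContDiffAt ℝ ∞ f N) :
    ContDiff ℝ ∞ fun z => f (normSq z) := by
  have h : ContDiff ℝ ∞ fun z : ℂ => z.re * z.re + z.im * z.im :=
    (reCLM.contDiff.mul reCLM.contDiff).add (imCLM.contDiff.mul imCLM.contDiff)
  exact contDiff_iff_contDiffAt.2 fun z => (hf _ normSq_mem_profileDomain).comp z h.contDiffAt

lemma contDiff_radialForm : ContDiff ℝ ∞ radialForm :=
  contDiff_const.clm_comp ((ContinuousLinearMap.mul ℝ ℂ).contDiff.comp conjCLE.contDiff)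

lemma contDiff_rotationForm : ContDiff ℝ ∞ rotationForm :=
  contDiff_const.clm_comp ((ContinuousLinearMap.mul ℝ ℂ).contDiff.comp conjCLE.contDiff)

lemma contDiff_surfaceForm : ContDiff ℝ ∞ (surfaceForm s) :=
  ((contDiff_comp_normSq fun _ => contDiffAt_tangentialScale).smul contDiff_const).add
    ((contDiff_comp_normSq fun _ => contDiffAt_radialExcess).smul
      (contDiff_radialForm.smulRight contDiff_id))

lemma contDiff_surfaceConnection : ContDiff ℝ ∞ (surfaceConnection s) :=
  (contDiff_comp_normSq fun _ => contDiffAt_connectionCoeff).smul contDiff_rotationForm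

lemma contDiff_surfaceScalar : ContDiff ℝ ∞ (surfaceScalar s) :=
  contDiff_comp_normSq fun _ => contDiffAt_scalarInvariant

lemma contDiff_surfaceVector : ContDiff ℝ ∞ (surfaceVector s) :=
  (contDiff_comp_normSq fun _ => contDiffAt_vectorCoeff).smul contDiff_id

lemma surfaceForm_eq_zero_iff {w : ℂ} : surfaceForm s ζ w = 0 ↔ w = 0 := by
  refine ⟨fun h => ?_, fun h => by rw [h, map_zero]⟩
  have hN : normSq ζ ∈ profileDomain s := normSq_mem_profileDomain
  have hradial : radialForm ζ w = 0 := by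
    have hw := radialForm_surfaceForm (s := s) (ζ := ζ) w
    rw [h, map_zero, eq_comm] at hw
    exact (mul_eq_zero.1 hw).resolve_left (one_div_pos.2 (pow_pos (radialRoot_pos hN) 2)).ne'
  rw [surfaceForm_apply, hradial, zero_smul, smul_zero, add_zero] at h
  exact (smul_eq_zero.1 h).resolve_left (tangentialScale_pos hN).ne'

end OrbitSurface

section Coframe

open scoped Quaternion

/-- The wedge product of two one-forms, evaluated on `v, w`. -/
def wedgeForm {E : Type*} [NormedAddCommGroup E] [NormedSpace ℝ E] (φ ψ : E →L[ℝ] ℝ) (v w : E) :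
    ℝ := φ v * ψ w - φ w * ψ v

/-- The components of the Maurer–Cartan form of `ℍˣ`. -/
def mcForm (i : Fin 4) (p : ℍ[ℝ]) : ℍ[ℝ] →L[ℝ] ℝ :=
  EuclideanSpace.proj i ∘L
    (Quaternion.linearIsometryEquivTuple : ℍ[ℝ] →L[ℝ] EuclideanSpace ℝ (Fin 4)) ∘L
      maurerCartanForm p

lemma hasExtDerivAt_mcForm (i : Fin 4) {p : ℍ[ℝ]} (hp : p ≠ 0) : HasExtDerivAt (mcForm i)
    (fun v w => ![0, -2 * wedgeForm (mcForm 2 p) (mcForm 3 p) v w,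
      -2 * wedgeForm (mcForm 3 p) (mcForm 1 p) v w,
      -2 * wedgeForm (mcForm 1 p) (mcForm 2 p) v w] i) p := by
  refine (((hasExtDerivAt_maurerCartanForm hp).clm_comp
    (Quaternion.linearIsometryEquivTuple : ℍ[ℝ] →L[ℝ] EuclideanSpace ℝ (Fin 4))).clm_comp
    (EuclideanSpace.proj i)).congr fun v w => ?_
  have hmc (j : Fin 4) (v : ℍ[ℝ]) :
      mcForm j p v = Quaternion.linearIsometryEquivTuple (maurerCartanForm p v) j := rfl
  fin_cases i <;> simp [wedgeForm, hmc] <;> ring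

variable (s : ℝ) {m : ℍ[ℝ] × ℂ}

/-- The real part of the Maurer–Cartan form, corrected by a multiple of the rotation form, so that
its curvature is that of `ω⁶`. -/
def fibreForm (m : ℍ[ℝ] × ℂ) : ℍ[ℝ] × ℂ →L[ℝ] ℝ :=
  fibreScale s (normSq m.2) •
    (mcForm 0 m.1 ∘L .fst ℝ ℍ[ℝ] ℂ +
      (fibreCoeff s (normSq m.2) • rotationForm m.2) ∘L .snd ℝ ℍ[ℝ] ℂ)

variable {s}

lemma hasExtDerivAt_fibreForm (hm : m.1 ≠ 0) : HasExtDerivAt (fibreForm s) (fun v w =>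
    -2 * surfaceScalar s m.2 * areaForm (surfaceForm s m.2 v.2) (surfaceForm s m.2 w.2) +
      (radialForm (surfaceVector s m.2) (surfaceForm s m.2 v.2) * fibreForm s m w -
        radialForm (surfaceVector s m.2) (surfaceForm s m.2 w.2) * fibreForm s m v)) m := by
  have hN : normSq m.2 ∈ profileDomain s := normSq_mem_profileDomain
  have hq := (hasFDerivAt_comp_normSq (hasDerivAt_fibreScale hN)).comp m hasFDerivAt_snd
  have hrot := hasExtDerivAt_comp_normSq_smul_rotationForm
    (hasDerivAt_fibreCoeff hN).differentiableAt
  refine ((((hasExtDerivAt_mcForm 0 hm).pullback fun _ => hasFDerivAt_fst).add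
    (hrot.pullback fun _ => hasFDerivAt_snd)).smul hq).congr fun v w => ?_
  have hq₀ := (fibreScale_pos hN).ne'
  simp only [fibreForm, radialForm_surfaceVector_surfaceForm, areaForm_surfaceForm, surfaceScalar,
    deriv_fibreCoeff_mul_add hN, smul_apply, add_apply, ContinuousLinearMap.comp_apply,
    ContinuousLinearMap.coe_fst', ContinuousLinearMap.coe_snd', smul_eq_mul, Matrix.cons_val,
    Function.comp_apply]
  field_simp
  ring

variable (s) in
/-- The connection form of the orbit surface, pulled back to `ℍˣ × ℂ`. -/
def connectionForm (m : ℍ[ℝ] × ℂ) : ℍ[ℝ] × ℂ →L[ℝ] ℝ := surfaceConnection s m.2 ∘L .snd ℝ ℍ[ℝ] ℂ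

variable (s) in
/-- The components `ω¹, …, ω⁶` of the left-invariant coframe on `ℍˣ × ℂ`. -/
def coframeForm : Fin 6 → ℍ[ℝ] × ℂ → ℍ[ℝ] × ℂ →L[ℝ] ℝ := ![
  fun m => (reCLM ∘L surfaceForm s m.2) ∘L .snd ℝ ℍ[ℝ] ℂ,
  fun m => (imCLM ∘L surfaceForm s m.2) ∘L .snd ℝ ℍ[ℝ] ℂ,
  fun m => (3⁻¹ : ℝ) • ((2 : ℝ) • mcForm 3 m.1 ∘L .fst ℝ ℍ[ℝ] ℂ + connectionForm s m +
    surfaceScalar s m.2 • fibreForm s m),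
  fun m => (3⁻¹ : ℝ) • ((2 : ℝ) • mcForm 1 m.1 ∘L .fst ℝ ℍ[ℝ] ℂ +
    surfaceScalar s m.2 • (reCLM ∘L surfaceForm s m.2) ∘L .snd ℝ ℍ[ℝ] ℂ +
    (surfaceVector s m.2).im • fibreForm s m),
  fun m => (3⁻¹ : ℝ) • ((2 : ℝ) • mcForm 2 m.1 ∘L .fst ℝ ℍ[ℝ] ℂ +
    surfaceScalar s m.2 • (imCLM ∘L surfaceForm s m.2) ∘L .snd ℝ ℍ[ℝ] ℂ +
    -(surfaceVector s m.2).re • fibreForm s m),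
  fibreForm s]

variable (s) in
/-- The left-invariant coframe on `ℍˣ × ℂ`. -/
def coframe (m : ℍ[ℝ] × ℂ) : ℍ[ℝ] × ℂ →L[ℝ] R6 :=
  ∑ i, (coframeForm s i m).smulRight (EuclideanSpace.single i 1)

lemma coframe_apply (v : ℍ[ℝ] × ℂ) (i : Fin 6) : coframe s m v i = coframeForm s i m v := by
  simp [coframe, Pi.single_apply]

lemma contDiffAt_mcForm_apply (i : Fin 4) (v : ℍ[ℝ] × ℂ) (hm : m.1 ≠ 0) :
    ContDiffAt ℝ ∞ (fun m : ℍ[ℝ] × ℂ => mcForm i m.1 v.1) m := by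
  have hinv : ContDiffAt ℝ ∞ (fun m : ℍ[ℝ] × ℂ => Ring.inverse m.1) m :=
    (contDiffAt_ringInverse ℝ (Units.mk0 m.1 hm)).comp m contDiffAt_fst
  simp only [Ring.inverse_eq_inv'] at hinv
  have hmul := hinv.mul (contDiffAt_const (c := v.1))
  have hcoord := (EuclideanSpace.proj i ∘L
    (Quaternion.linearIsometryEquivTuple : ℍ[ℝ] →L[ℝ] EuclideanSpace ℝ (Fin 4))).contDiff (n := ∞)
  exact hcoord.contDiffAt.comp m hmul

lemma contDiff_comp_snd {F : Type*} [NormedAddCommGroup F] [NormedSpace ℝ F] {φ : ℂ → F}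
    (hφ : ContDiff ℝ ∞ φ) : ContDiff ℝ ∞ fun m : ℍ[ℝ] × ℂ => φ m.2 :=
  hφ.comp contDiff_snd

lemma contDiffAt_fibreForm_apply (v : ℍ[ℝ] × ℂ) (hm : m.1 ≠ 0) :
    ContDiffAt ℝ ∞ (fun m => fibreForm s m v) m := by
  have hq := contDiff_comp_snd (contDiff_comp_normSq fun _ => contDiffAt_fibreScale (s := s))
  have hc := contDiff_comp_snd (contDiff_comp_normSq fun _ => contDiffAt_fibreCoeff (s := s))
  have hrot := contDiff_comp_snd (contDiff_rotationForm.clm_apply (contDiff_const (c := v.2)))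
  exact hq.contDiffAt.mul ((contDiffAt_mcForm_apply 0 v hm).add (hc.mul hrot).contDiffAt)

lemma contDiffAt_coframeForm_apply (i : Fin 6) (v : ℍ[ℝ] × ℂ) (hm : m.1 ≠ 0) :
    ContDiffAt ℝ ∞ (fun m => coframeForm s i m v) m := by
  have hmc (i : Fin 4) := contDiffAt_mcForm_apply i v hm
  have hfib := contDiffAt_fibreForm_apply (s := s) v hm
  have hη := contDiff_surfaceForm (s := s).clm_apply (contDiff_const (c := v.2))
  have hη₁ := (contDiff_comp_snd (reCLM.contDiff.comp hη)).contDiffAt (x := m)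
  have hη₂ := (contDiff_comp_snd (imCLM.contDiff.comp hη)).contDiffAt (x := m)
  have hβ := (contDiff_comp_snd ((contDiff_surfaceConnection (s := s)).clm_apply
    (contDiff_const (c := v.2)))).contDiffAt (x := m)
  have ha₀ := (contDiff_comp_snd (contDiff_surfaceScalar (s := s))).contDiffAt (x := m)
  have ha₁ := (contDiff_comp_snd
    (reCLM.contDiff.comp (contDiff_surfaceVector (s := s)))).contDiffAt (x := m)
  have ha₂ := (contDiff_comp_snd
    (imCLM.contDiff.comp (contDiff_surfaceVector (s := s)))).contDiffAt (x := m)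
  fin_cases i
  · exact hη₁
  · exact hη₂
  · exact contDiffAt_const.mul (((contDiffAt_const.mul (hmc 3)).add hβ).add (ha₀.mul hfib))
  · exact contDiffAt_const.mul
      (((contDiffAt_const.mul (hmc 1)).add (ha₀.mul hη₁)).add (ha₂.mul hfib))
  · exact contDiffAt_const.mul
      (((contDiffAt_const.mul (hmc 2)).add (ha₀.mul hη₂)).add (ha₁.neg.mul hfib))
  · exact hfib

lemma contDiffOn_coframe : ContDiffOn ℝ ∞ (coframe s) {m | m.1 ≠ 0} := by
  refine contDiffOn_clm_apply.2 fun v => (contDiffOn_piLp 2).2 fun i => ?_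
  simp only [coframe_apply]
  exact fun m hm => (contDiffAt_coframeForm_apply i v hm).contDiffWithinAt

lemma mcForm_eq_zero {p q : ℍ[ℝ]} (hp : p ≠ 0) (h : ∀ i, mcForm i p q = 0) : q = 0 := by
  have hq : Quaternion.linearIsometryEquivTuple (p⁻¹ * q) = 0 := PiLp.ext h
  rw [map_eq_zero_iff _ Quaternion.linearIsometryEquivTuple.injective] at hq
  exact (mul_eq_zero.1 hq).resolve_left (inv_ne_zero hp)

lemma coframe_apply_eq_zero_iff (v : ℍ[ℝ] × ℂ) :
    coframe s m v 0 = 0 ∧ coframe s m v 1 = 0 ↔ v.2 = 0 := by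
  rw [coframe_apply, coframe_apply, ← surfaceForm_eq_zero_iff (s := s) (ζ := m.2),
    Complex.ext_iff]
  rfl

lemma coframe_bijective (hm : m.1 ≠ 0) : Function.Bijective (coframe s m) := by
  have hinj : Function.Injective (coframe s m) := by
    refine (injective_iff_map_eq_zero _).2 fun v hv => ?_
    have hform (i : Fin 6) : coframeForm s i m v = 0 := by rw [← coframe_apply, hv]; rfl
    have hsurf : v.2 = 0 := (coframe_apply_eq_zero_iff v).1 (by rw [hv]; exact ⟨rfl, rfl⟩)
    have hfib : fibreForm s m v = 0 := hform 5
    have hq := (fibreScale_pos (normSq_mem_profileDomain (s := s) (ζ := m.2))).ne'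
    have h₀ : mcForm 0 m.1 v.1 = 0 := by simpa [fibreForm, hq, hsurf] using hfib
    have h₁ : mcForm 1 m.1 v.1 = 0 := by simpa [coframeForm, hfib, hsurf] using hform 3
    have h₂ : mcForm 2 m.1 v.1 = 0 := by simpa [coframeForm, hfib, hsurf] using hform 4
    have h₃ : mcForm 3 m.1 v.1 = 0 := by
      simpa [coframeForm, connectionForm, hfib, hsurf] using hform 2
    have hmc (i : Fin 4) : mcForm i m.1 v.1 = 0 := by
      fin_cases i
      exacts [h₀, h₁, h₂, h₃]
    exact Prod.ext (mcForm_eq_zero hm hmc) hsurf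
  have hdim : Module.finrank ℝ (ℍ[ℝ] × ℂ) = Module.finrank ℝ R6 := by
    rw [Module.finrank_prod, Quaternion.finrank_eq_four, Complex.finrank_real_complex,
      finrank_euclideanSpace_fin]
  exact ⟨hinj, (LinearMap.injective_iff_surjective_of_finrank_eq_finrank hdim).1 hinj⟩

lemma extDerivOneForm_coframe_apply (hm : m.1 ≠ 0) {i : Fin 6}
    {B : ℍ[ℝ] × ℂ → ℍ[ℝ] × ℂ → ℝ} (h : HasExtDerivAt (coframeForm s i) B m)
    (v w : ℍ[ℝ] × ℂ) : extDerivOneForm (coframe s) m v w i = B v w := by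
  have hopen : IsOpen {m : ℍ[ℝ] × ℂ | m.1 ≠ 0} := isOpen_ne_fun continuous_fst continuous_const
  have hdiff : DifferentiableAt ℝ (coframe s) m :=
    (contDiffOn_coframe.contDiffAt (hopen.mem_nhds hm)).differentiableAt (by simp)
  have hcomp : coframeForm s i = fun m => EuclideanSpace.proj i ∘L coframe s m :=
    funext fun m => ContinuousLinearMap.ext fun v => (coframe_apply v i).symm
  rw [← h.2, hcomp, extDerivOneForm_clm_comp _ hdiff]
  rfl

end Coframe

section CoframeEquations

open scoped Quaternion

variable {s : ℝ} {m : ℍ[ℝ] × ℂ}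

lemma coframeForm_apply (i : Fin 6) (v : ℍ[ℝ] × ℂ) : coframeForm s i m v = ![
    (surfaceForm s m.2 v.2).re,
    (surfaceForm s m.2 v.2).im,
    3⁻¹ * (2 * mcForm 3 m.1 v.1 + connectionForm s m v + surfaceScalar s m.2 * fibreForm s m v),
    3⁻¹ * (2 * mcForm 1 m.1 v.1 + surfaceScalar s m.2 * (surfaceForm s m.2 v.2).re +
      (surfaceVector s m.2).im * fibreForm s m v),
    3⁻¹ * (2 * mcForm 2 m.1 v.1 + surfaceScalar s m.2 * (surfaceForm s m.2 v.2).im +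
      -(surfaceVector s m.2).re * fibreForm s m v),
    fibreForm s m v] i := by
  fin_cases i <;> rfl

lemma hasExtDerivAt_coframeForm_zero : HasExtDerivAt (coframeForm s 0) (fun v w =>
    -wedgeConn (connectionForm s m).toLinearMap (coframe s m) 1 v w) m := by
  refine ((hasExtDerivAt_surfaceForm.clm_comp reCLM).pullback
    fun _ => hasFDerivAt_snd).congr fun v w => ?_
  simp only [wedgeConn, coframe_apply, coframeForm_apply, connectionForm, Matrix.cons_val,
    reCLM_apply, ContinuousLinearMap.coe_coe, ContinuousLinearMap.comp_apply,
    ContinuousLinearMap.coe_snd', mul_re, mul_im, sub_re, sub_im, I_re, I_im, ofReal_re, ofReal_im]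
  ring

lemma hasExtDerivAt_coframeForm_one : HasExtDerivAt (coframeForm s 1) (fun v w =>
    wedgeConn (connectionForm s m).toLinearMap (coframe s m) 0 v w) m := by
  refine ((hasExtDerivAt_surfaceForm.clm_comp imCLM).pullback
    fun _ => hasFDerivAt_snd).congr fun v w => ?_
  simp only [wedgeConn, coframe_apply, coframeForm_apply, connectionForm, Matrix.cons_val,
    imCLM_apply, ContinuousLinearMap.coe_coe, ContinuousLinearMap.comp_apply,
    ContinuousLinearMap.coe_snd', mul_re, mul_im, sub_re, sub_im, I_re, I_im, ofReal_re, ofReal_im]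
  ring

lemma hasExtDerivAt_mcForm_fst (i : Fin 4) (hm : m.1 ≠ 0) :
    HasExtDerivAt (fun m : ℍ[ℝ] × ℂ => (2 : ℝ) • mcForm i m.1 ∘L .fst ℝ ℍ[ℝ] ℂ)
    (fun v w => ![0, -4 * wedgeForm (mcForm 2 m.1) (mcForm 3 m.1) v.1 w.1,
      -4 * wedgeForm (mcForm 3 m.1) (mcForm 1 m.1) v.1 w.1,
      -4 * wedgeForm (mcForm 1 m.1) (mcForm 2 m.1) v.1 w.1] i) m := by
  refine (((hasExtDerivAt_mcForm i hm).pullback fun _ => hasFDerivAt_fst).clm_comp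
    ((2 : ℝ) • .id ℝ ℝ)).congr fun v w => ?_
  fin_cases i <;> simp <;> ring

lemma hasExtDerivAt_coframeForm_two (hm : m.1 ≠ 0) : HasExtDerivAt (coframeForm s 2) (fun v w =>
    wedgeComp (coframe s m) 0 1 v w + surfaceScalar s m.2 *
        (wedgeComp (coframe s m) 0 4 v w - wedgeComp (coframe s m) 1 3 v w) -
      3 * wedgeComp (coframe s m) 3 4 v w -
      ((surfaceVector s m.2).re * wedgeComp (coframe s m) 3 5 v w +
        (surfaceVector s m.2).im * wedgeComp (coframe s m) 4 5 v w)) m := by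
  have hmc := hasExtDerivAt_mcForm_fst 3 hm
  have hβ := hasExtDerivAt_surfaceConnection (s := s) (ζ := m.2) |>.pullback
    fun _ => hasFDerivAt_snd
  have ha₀ := (hasFDerivAt_surfaceScalar (s := s)).comp m hasFDerivAt_snd
  have hfib := (hasExtDerivAt_fibreForm (s := s) hm).smul ha₀
  refine (((hmc.add hβ).add hfib).smul (hasFDerivAt_const 3⁻¹ m)).congr fun v w => ?_
  simp only [wedgeComp, wedgeForm, coframe_apply, coframeForm_apply, connectionForm, areaForm,
    radialForm_apply, Matrix.cons_val, ContinuousLinearMap.comp_apply, ContinuousLinearMap.coe_snd',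
    Function.comp_apply, smul_apply, zero_apply, smul_eq_mul]
  ring

lemma hasExtDerivAt_coframeForm_three (hm : m.1 ≠ 0) :
    HasExtDerivAt (coframeForm s 3) (fun v w =>
      surfaceScalar s m.2 * wedgeComp (coframe s m) 1 2 v w - wedgeComp (coframe s m) 1 5 v w -
        wedgeConn (connectionForm s m).toLinearMap (coframe s m) 4 v w -
        3 * wedgeComp (coframe s m) 4 2 v w +
        surfaceScalar s m.2 * wedgeComp (coframe s m) 4 5 v w +
        (surfaceVector s m.2).re * wedgeComp (coframe s m) 2 5 v w) m := by
  have ha₀ := (hasFDerivAt_surfaceScalar (s := s)).comp m hasFDerivAt_snd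
  have ha₂ := imCLM.hasFDerivAt.comp m ((hasFDerivAt_surfaceVector (s := s)).comp m hasFDerivAt_snd)
  have hmc := hasExtDerivAt_mcForm_fst 1 hm
  have hη := (hasExtDerivAt_coframeForm_zero (s := s)).smul ha₀
  have hfib := (hasExtDerivAt_fibreForm (s := s) hm).smul ha₂
  refine (((hmc.add hη).add hfib).smul (hasFDerivAt_const 3⁻¹ m)).congr fun v w => ?_
  simp only [wedgeComp, wedgeConn, wedgeForm, coframe_apply, coframeForm_apply, connectionForm,
    areaForm, radialForm_apply, Matrix.cons_val, imCLM_apply, ContinuousLinearMap.comp_apply,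
    ContinuousLinearMap.coe_snd', ContinuousLinearMap.coe_coe,
    ContinuousLinearMap.smulRight_apply, Function.comp_apply, add_apply, sub_apply, smul_apply,
    zero_apply, mul_im, I_re, I_im, add_im, sub_im, smul_im, smul_eq_mul]
  ring
lemma hasExtDerivAt_coframeForm_four (hm : m.1 ≠ 0) :
    HasExtDerivAt (coframeForm s 4) (fun v w =>
      -surfaceScalar s m.2 * wedgeComp (coframe s m) 0 2 v w + wedgeComp (coframe s m) 0 5 v w +
        wedgeConn (connectionForm s m).toLinearMap (coframe s m) 3 v w +
        3 * wedgeComp (coframe s m) 3 2 v w -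
        surfaceScalar s m.2 * wedgeComp (coframe s m) 3 5 v w +
        (surfaceVector s m.2).im * wedgeComp (coframe s m) 2 5 v w) m := by
  have ha₀ := (hasFDerivAt_surfaceScalar (s := s)).comp m hasFDerivAt_snd
  have ha₁ := reCLM.hasFDerivAt.comp m ((hasFDerivAt_surfaceVector (s := s)).comp m hasFDerivAt_snd)
  have hmc := hasExtDerivAt_mcForm_fst 2 hm
  have hη := (hasExtDerivAt_coframeForm_one (s := s)).smul ha₀
  have hfib := (hasExtDerivAt_fibreForm (s := s) hm).smul ha₁.fun_neg
  refine (((hmc.add hη).add hfib).smul (hasFDerivAt_const 3⁻¹ m)).congr fun v w => ?_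
  simp only [wedgeComp, wedgeConn, wedgeForm, coframe_apply, coframeForm_apply, connectionForm,
    areaForm, radialForm_apply, Matrix.cons_val, reCLM_apply, ContinuousLinearMap.comp_apply,
    ContinuousLinearMap.coe_snd', ContinuousLinearMap.coe_coe,
    ContinuousLinearMap.smulRight_apply, Function.comp_apply, add_apply, sub_apply, neg_apply,
    smul_apply, zero_apply, mul_re, I_re, I_im, add_re, sub_re, smul_re, smul_eq_mul]
  ring

lemma hasExtDerivAt_coframeForm_five (hm : m.1 ≠ 0) :
    HasExtDerivAt (coframeForm s 5) (fun v w =>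
      -2 * surfaceScalar s m.2 * wedgeComp (coframe s m) 0 1 v w +
        ((surfaceVector s m.2).re * wedgeComp (coframe s m) 0 5 v w +
          (surfaceVector s m.2).im * wedgeComp (coframe s m) 1 5 v w)) m := by
  refine (hasExtDerivAt_fibreForm hm).congr fun v w => ?_
  simp only [wedgeComp, coframe_apply, coframeForm_apply, areaForm, radialForm_apply,
    Matrix.cons_val]
  ring

lemma reducedEquations_coframe (hm : m.1 ≠ 0) :
    ReducedEquations (coframe s m) (extDerivOneForm (coframe s) m)
      (connectionForm s m).toLinearMap (surfaceVector s m.2).re (surfaceVector s m.2).im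
      (surfaceScalar s m.2) where
  d₁ := extDerivOneForm_coframe_apply hm hasExtDerivAt_coframeForm_zero
  d₂ := extDerivOneForm_coframe_apply hm hasExtDerivAt_coframeForm_one
  d₃ := extDerivOneForm_coframe_apply hm (hasExtDerivAt_coframeForm_two hm)
  d₄ := extDerivOneForm_coframe_apply hm (hasExtDerivAt_coframeForm_three hm)
  d₅ := extDerivOneForm_coframe_apply hm (hasExtDerivAt_coframeForm_four hm)
  d₆ := extDerivOneForm_coframe_apply hm (hasExtDerivAt_coframeForm_five hm)

end CoframeEquations

section InitialValues

lemma exists_torsion_parameter {p : ℝ} (hp : 0 < p) (z : ℝ) :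
    ∃ s : ℝ, 0 < 3 - s * z ∧ (3 - s * z) * (z - s) = s * p := by
  -- With `s = c z` the equation reads `ψ c = 0` up to the factor `z`.
  let ψ : ℝ → ℝ := fun c => (3 - c * z ^ 2) * (1 - c) - c * p
  have hψ : Continuous ψ := by fun_prop
  obtain ⟨b, hb, hbz, hψb⟩ : ∃ b, 0 < b ∧ b * z ^ 2 ≤ 3 ∧ ψ b ≤ 0 := by
    rcases le_total (z ^ 2) 3 with hz | hz
    · exact ⟨1, one_pos, by rwa [one_mul], by simp only [ψ]; linarith⟩
    · have hz₀ : 0 < z ^ 2 := by linarith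
      have hb : 3 / z ^ 2 * z ^ 2 = 3 := div_mul_cancel₀ 3 hz₀.ne'
      refine ⟨3 / z ^ 2, by positivity, hb.le, ?_⟩
      simp only [ψ, hb, sub_self, zero_mul, zero_sub, neg_nonpos]
      positivity
  have hzero : (0 : ℝ) ∈ Icc (ψ b) (ψ 0) := ⟨hψb, by norm_num [ψ]⟩
  obtain ⟨c, ⟨-, hcb⟩, hc⟩ := intermediate_value_Icc' hb.le hψ.continuousOn hzero
  have hprod : (3 - c * z ^ 2) * (1 - c) = c * p := sub_eq_zero.1 hc
  have hnonneg : 0 ≤ 3 - c * z ^ 2 :=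
    sub_nonneg.2 ((mul_le_mul_of_nonneg_right hcb (sq_nonneg z)).trans hbz)
  have hne : 3 - c * z ^ 2 ≠ 0 := by
    intro h
    rw [h, zero_mul, eq_comm, mul_eq_zero, or_iff_left hp.ne'] at hprod
    norm_num [hprod] at h
  refine ⟨c * z, ?_, by linear_combination z * hprod⟩
  rw [mul_assoc, ← sq]
  exact hnonneg.lt_of_ne' hne

theorem exists_invariants (a : ℂ) (z : ℝ) :
    ∃ (s : ℝ) (ζ : ℂ), surfaceVector s ζ = a ∧ surfaceScalar s ζ = z := by
  rcases eq_or_ne a 0 with rfl | ha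
  · exact ⟨z, 0, smul_zero _, by simp [surfaceScalar, scalarInvariant, radialRoot, torsionRoot]⟩
  obtain ⟨s, hk, hs⟩ := exists_torsion_parameter (normSq_pos.2 ha) z
  obtain ⟨ζ, hζ⟩ : ∃ ζ, ζ = -(3 - s * z)⁻¹ • a := ⟨_, rfl⟩
  have hN : normSq ζ = normSq a / (3 - s * z) ^ 2 := by
    rw [hζ, real_smul, normSq_mul, normSq_ofReal]
    field_simp
  have hdom := mem_profileDomain_of_nonneg s (normSq_nonneg ζ)
  have ht : 0 < 1 + s ^ 2 * normSq ζ := hdom.2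
  have hvector : vectorCoeff s (normSq ζ) = -(3 - s * z) := by
    rw [vectorCoeff, sq_torsionRoot hdom, div_eq_iff ht.ne', hN]
    field_simp
    linear_combination -s * hs
  refine ⟨s, ζ, ?_, ?_⟩
  · rw [surfaceVector, hvector, hζ, smul_smul, neg_mul_neg, mul_inv_cancel₀ hk.ne', one_smul]
  · rw [surfaceScalar, scalarInvariant, sq_torsionRoot hdom, sq_radialRoot hdom,
      div_eq_iff ht.ne', hN]
    field_simp
    linear_combination -(3 - s * z) * hs

end InitialValues

section Action

open scoped Quaternion

/-- The splitting `ℝ⁶ ≅ ℍ × ℂ` into the first four and the last two coordinates. -/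
def splitting : R6 ≃L[ℝ] ℍ[ℝ] × ℂ :=
  LinearEquiv.toContinuousLinearEquiv
    { toFun := fun v => (⟨v 0, v 1, v 2, v 3⟩, ⟨v 4, v 5⟩)
      invFun := fun m => !₂[m.1.re, m.1.imI, m.1.imJ, m.1.imK, m.2.re, m.2.im]
      map_add' := fun _ _ => rfl
      map_smul' := fun c v => Prod.ext rfl (Complex.ext (by simp) (by simp))
      left_inv := fun v => by
        ext i
        fin_cases i <;> rfl
      right_inv := fun _ => rfl }

/-- The affine chart of `ℝ⁶` with values in `ℍ × ℂ` whose origin is `-o`. -/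
def chart (o : R6) : R6 ≃ₜ ℍ[ℝ] × ℂ := (Homeomorph.addRight o).trans splitting.toHomeomorph

lemma chart_apply (o z : R6) : chart o z = splitting (z + o) := rfl

/-- The set of points of `ℝ⁶` whose quaternionic coordinate is not zero. -/
def domain (o : R6) : Set R6 := chart o ⁻¹' {m | m.1 ≠ 0}

/-- The left-invariant coframe on `ℍˣ × ℂ`, transported to `ℝ⁶` by the chart. -/
def coframeField (s : ℝ) (o z : R6) : R6 →L[ℝ] R6 := coframe s (chart o z) ∘L splitting

/-- Left multiplication on the first factor of `ℍ × ℂ`. -/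
def leftMul (g : ℍ[ℝ]) : ℍ[ℝ] × ℂ →L[ℝ] ℍ[ℝ] × ℂ :=
  (ContinuousLinearMap.mul ℝ ℍ[ℝ] g).prodMap (.id ℝ ℂ)

/-- The action of `ℍˣ` by left multiplication on `ℍ × ℂ`, transported to `ℝ⁶` by the chart. -/
def leftAct (o : R6) (g : ℍ[ℝ]ˣ) (z : R6) : R6 := (chart o).symm (leftMul g (chart o z))

variable {o y : R6} {s : ℝ}

lemma hasFDerivAt_chart (o z : R6) : HasFDerivAt (chart o) (splitting : R6 →L[ℝ] ℍ[ℝ] × ℂ) z := by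
  exact splitting.hasFDerivAt.comp z ((hasFDerivAt_id z).add_const o)

lemma hasFDerivAt_chart_symm (o : R6) (m : ℍ[ℝ] × ℂ) :
    HasFDerivAt (chart o).symm (splitting.symm : ℍ[ℝ] × ℂ →L[ℝ] R6) m :=
  splitting.symm.hasFDerivAt.add_const (-o)

lemma isOpen_domain (o : R6) : IsOpen (domain o) :=
  (isOpen_ne_fun continuous_fst continuous_const).preimage (chart o).continuous

lemma isConnected_compl_zero_quaternion : IsConnected ({0}ᶜ : Set ℍ[ℝ]) :=
  isConnected_compl_singleton_of_one_lt_rank (by rw [Quaternion.rank_eq_four]; norm_num) 0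

lemma isConnected_domain (o : R6) : IsConnected (domain o) := by
  have hprod : {m : ℍ[ℝ] × ℂ | m.1 ≠ 0} = {0}ᶜ ×ˢ univ := by ext; simp
  rw [domain, hprod, (chart o).isConnected_preimage]
  exact isConnected_compl_zero_quaternion.prod isConnected_univ

lemma connectedSpace_quaternion_units : ConnectedSpace ℍ[ℝ]ˣ := by
  have : ConnectedSpace {p : ℍ[ℝ] // p ≠ 0} :=
    isConnected_iff_connectedSpace.1 isConnected_compl_zero_quaternion
  exact unitsHomeomorphNeZero.symm.surjective.connectedSpace unitsHomeomorphNeZero.symm.continuous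

lemma contDiffOn_coframeField : ContDiffOn ℝ ∞ (coframeField s o) (domain o) := by
  have hchart : ContDiff ℝ ∞ (chart o) := splitting.contDiff.comp (contDiff_id.add contDiff_const)
  exact (contDiffOn_coframe.comp hchart.contDiffOn fun _ hz => hz).clm_comp contDiffOn_const

lemma coframeField_bijective (hy : y ∈ domain o) : Function.Bijective (coframeField s o y) :=
  (coframe_bijective hy).comp splitting.bijective

lemma extDerivOneForm_coframeField (hy : y ∈ domain o) : extDerivOneForm (coframeField s o) y =
    fun v w => extDerivOneForm (coframe s) (chart o y) (splitting v) (splitting w) := by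
  have hopen : IsOpen {m : ℍ[ℝ] × ℂ | m.1 ≠ 0} := isOpen_ne_fun continuous_fst continuous_const
  have hd : DifferentiableAt ℝ (coframe s) (chart o y) :=
    (contDiffOn_coframe.contDiffAt (hopen.mem_nhds hy)).differentiableAt (by simp)
  exact funext₂ (HasExtDerivAt.pullback (hasFDerivAt_chart o) ⟨hd, fun _ _ => rfl⟩).2

lemma reducedEquations_coframeField (hy : y ∈ domain o) :
    ReducedEquations (coframeField s o y) (extDerivOneForm (coframeField s o) y)
      ((connectionForm s (chart o y)).toLinearMap ∘ₗ splitting.toLinearMap)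
      (surfaceVector s (chart o y).2).re (surfaceVector s (chart o y).2).im
      (surfaceScalar s (chart o y).2) := by
  rw [extDerivOneForm_coframeField hy]
  exact (reducedEquations_coframe hy).comp (splitting : R6 →L[ℝ] ℍ[ℝ] × ℂ)

lemma chart_leftAct (g : ℍ[ℝ]ˣ) (z : R6) : chart o (leftAct o g z) = leftMul g (chart o z) :=
  (chart o).apply_symm_apply _

lemma leftMul_one (m : ℍ[ℝ] × ℂ) : leftMul 1 m = m := Prod.ext (one_mul m.1) rfl

lemma leftMul_mul (g h : ℍ[ℝ]) (m : ℍ[ℝ] × ℂ) : leftMul (g * h) m = leftMul g (leftMul h m) :=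
  Prod.ext (mul_assoc g h m.1) rfl

lemma hasFDerivAt_leftAct (g : ℍ[ℝ]ˣ) (z : R6) : HasFDerivAt (leftAct o g)
    (splitting.symm ∘L leftMul g ∘L splitting : R6 →L[ℝ] R6) z :=
  (hasFDerivAt_chart_symm o _).comp z
    ((leftMul (g : ℍ[ℝ])).hasFDerivAt.comp z (hasFDerivAt_chart o z))

lemma splitting_fderiv_leftAct (g : ℍ[ℝ]ˣ) (z v : R6) :
    splitting (fderiv ℝ (leftAct o g) z v) = leftMul g (splitting v) := by
  rw [(hasFDerivAt_leftAct g z).fderiv]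
  exact splitting.apply_symm_apply _

lemma maurerCartanForm_units_mul (g : ℍ[ℝ]ˣ) (p q : ℍ[ℝ]) :
    maurerCartanForm (g * p) (g * q) = maurerCartanForm p q := by
  change (g * p)⁻¹ * (g * q) = p⁻¹ * q
  rw [mul_inv_rev, mul_assoc, inv_mul_cancel_left₀ g.ne_zero]

lemma coframe_leftMul (g : ℍ[ℝ]ˣ) (m v : ℍ[ℝ] × ℂ) :
    coframe s (leftMul g m) (leftMul g v) = coframe s m v := by
  have hmc (i : Fin 4) : mcForm i (g * m.1) (g * v.1) = mcForm i m.1 v.1 := by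
    simp only [mcForm, ContinuousLinearMap.comp_apply, maurerCartanForm_units_mul]
  ext i
  simp only [coframe_apply, coframeForm_apply]
  fin_cases i <;> simp [leftMul, fibreForm, connectionForm, hmc]

lemma coframeField_leftAct (g : ℍ[ℝ]ˣ) (z v : R6) :
    coframeField s o (leftAct o g z) (fderiv ℝ (leftAct o g) z v) = coframeField s o z v := by
  simp only [coframeField, ContinuousLinearMap.comp_apply, ContinuousLinearEquiv.coe_coe,
    splitting_fderiv_leftAct, chart_leftAct, coframe_leftMul]

lemma isSmoothActionOn_leftAct : IsSmoothActionOn (V := ℍ[ℝ]) (leftAct o) (domain o) where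
  mapsTo g z hz := by
    rw [domain, mem_preimage, chart_leftAct]
    exact mul_ne_zero g.ne_zero hz
  one z _ := by rw [leftAct, Units.val_one, leftMul_one, Homeomorph.symm_apply_apply]
  mul g h z _ := (chart o).injective (by simp only [chart_leftAct, Units.val_mul, leftMul_mul])
  smooth := by
    have hchart : ContDiff ℝ ∞ fun p : ℍ[ℝ] × R6 => chart o p.2 :=
      splitting.contDiff.comp (contDiff_snd.add contDiff_const)
    have hact : ContDiff ℝ ∞ fun p : ℍ[ℝ] × R6 => (chart o).symm (leftMul p.1 (chart o p.2)) :=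
      (splitting.symm.contDiff.comp
        ((contDiff_fst.mul (contDiff_fst.comp hchart)).prodMk (contDiff_snd.comp hchart))).add
          contDiff_const
    have hunits : ContMDiff (𝓘(ℝ, ℍ[ℝ]).prod 𝓘(ℝ, R6)) 𝓘(ℝ, ℍ[ℝ] × R6) ∞
        fun p : ℍ[ℝ]ˣ × R6 => ((p.1 : ℍ[ℝ]), p.2) :=
      (Units.contMDiff_val.comp contMDiff_fst).prodMk_space contMDiff_snd
    exact (hact.contMDiff.comp hunits).contMDiffOn

/-- The differential at `1` of the orbit map `g ↦ g y`. -/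
def orbitDifferential (o y : R6) : ℍ[ℝ] →L[ℝ] R6 :=
  splitting.symm ∘L .inl ℝ ℍ[ℝ] ℂ ∘L (ContinuousLinearMap.mul ℝ ℍ[ℝ]).flip (chart o y).1

lemma orbitTangent_leftAct (y : R6) : orbitTangent (V := ℍ[ℝ]) (leftAct o) y =
    LinearMap.range (orbitDifferential o y).toLinearMap := by
  have hinner : HasFDerivAt (fun p : ℍ[ℝ] => (p * (chart o y).1, (chart o y).2))
      (.inl ℝ ℍ[ℝ] ℂ ∘L (ContinuousLinearMap.mul ℝ ℍ[ℝ]).flip (chart o y).1) ((1 : ℍ[ℝ]ˣ) : ℍ[ℝ]) :=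
    (((ContinuousLinearMap.mul ℝ ℍ[ℝ]).flip (chart o y).1).hasFDerivAt).prodMk
      (hasFDerivAt_const _ _)
  have horbit := ((hasFDerivAt_chart_symm o _).comp _ hinner).hasMFDerivAt.comp (1 : ℍ[ℝ]ˣ)
    (hasMFDerivAt_unitsVal (1 : ℍ[ℝ]ˣ))
  have hmf : mfderiv 𝓘(ℝ, ℍ[ℝ]) 𝓘(ℝ, R6) (fun g : ℍ[ℝ]ˣ => leftAct o g y) 1 =
      orbitDifferential o y := horbit.mfderiv
  rw [orbitTangent, hmf]
  rfl

lemma mem_orbitTangent_leftAct (hy : y ∈ domain o) (v : R6) :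
    v ∈ orbitTangent (V := ℍ[ℝ]) (leftAct o) y ↔ (splitting v).2 = 0 := by
  rw [orbitTangent_leftAct, LinearMap.mem_range]
  constructor
  · rintro ⟨p, rfl⟩
    rfl
  · intro hv
    refine ⟨(splitting v).1 * (chart o y).1⁻¹, splitting.injective (Prod.ext ?_ hv.symm)⟩
    exact inv_mul_cancel_right₀ hy _

lemma orbitDifferential_injective (hy : y ∈ domain o) :
    Function.Injective (orbitDifferential o y) := fun _ _ h =>
  mul_right_cancel₀ hy (congrArg (fun v => (splitting v).1) h)

lemma finrank_orbitTangent_leftAct (hy : y ∈ domain o) :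
    Module.finrank ℝ (orbitTangent (V := ℍ[ℝ]) (leftAct o) y) = 4 := by
  rw [orbitTangent_leftAct, LinearMap.finrank_range_of_inj (orbitDifferential_injective hy),
    Quaternion.finrank_eq_four]

lemma isO2Coframe_coframeField (hy : y ∈ domain o) :
    IsO2Coframe (omegaOf (coframeField s o)) (upsilonOf (coframeField s o))
      (orbitTangent (V := ℍ[ℝ]) (leftAct o)) y (coframeField s o y) :=
  ⟨isSU3Coframe_of_bijective _ (coframeField_bijective hy), fun v =>
    (mem_orbitTangent_leftAct hy v).trans (coframe_apply_eq_zero_iff (splitting v)).symm⟩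

lemma leftAct_eq_self_iff (hy : y ∈ domain o) (g : ℍ[ℝ]ˣ) : leftAct o g y = y ↔ g = 1 := by
  refine ⟨fun h => ?_, fun h => h ▸ isSmoothActionOn_leftAct.one y hy⟩
  have hg : g * (chart o y).1 = (chart o y).1 :=
    congrArg Prod.fst ((chart_leftAct g y).symm.trans (congrArg (chart o) h))
  exact Units.ext (mul_right_cancel₀ hy (hg.trans (one_mul _).symm))

lemma chart_symm_one_mem_domain (o : R6) : (chart o).symm (1, 0) ∈ domain o := by
  rw [domain, mem_preimage, Homeomorph.apply_symm_apply]
  exact one_ne_zero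

lemma exists_leftAct_eqOn_of_tendsto (g : ℕ → ℍ[ℝ]ˣ) {h : R6 → R6}
    (hmaps : MapsTo h (domain o) (domain o))
    (hlim : ∀ z ∈ domain o, Tendsto (fun n => leftAct o (g n) z) atTop (𝓝 (h z))) :
    ∃ k : ℍ[ℝ]ˣ, EqOn (leftAct o k) h (domain o) := by
  have hone := chart_symm_one_mem_domain o
  -- The quaternions `g n` are read off the images of the point with coordinates `(1, 0)`.
  have hg : Tendsto (fun n => (g n : ℍ[ℝ])) atTop (𝓝 (chart o (h ((chart o).symm (1, 0)))).1) := by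
    refine (((continuous_fst.comp (chart o).continuous).tendsto _).comp (hlim _ hone)).congr
      fun n => ?_
    simp only [Function.comp_apply, chart_leftAct, Homeomorph.apply_symm_apply]
    exact mul_one _
  refine ⟨Units.mk0 _ (hmaps hone), fun z hz => tendsto_nhds_unique ?_ (hlim z hz)⟩
  exact ((chart o).symm.continuous.tendsto _).comp
    ((hg.mul_const (chart o z).1).prodMk_nhds tendsto_const_nhds)

lemma omegaSq_omegaOf_eq_zero {σ : R6 → R6 →L[ℝ] R6} {v : Fin 4 → R6}
    (hv : ∀ i, σ y (v i) 0 = 0 ∧ σ y (v i) 1 = 0) : omegaSq (omegaOf σ) y v = 0 := by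
  have hΩ (i j : Fin 4) : omegaOf σ y ![v i, v j] =
      σ y (v i) 2 * σ y (v j) 5 - σ y (v i) 5 * σ y (v j) 2 := by
    rw [omegaOf_apply]
    simp [stdOmega, hv]
  simp only [omegaSq, hΩ]
  ring

theorem isCohomTwoSymmetry_leftAct : IsCohomTwoSymmetry (V := ℍ[ℝ]) (domain o)
    (omegaOf (coframeField s o)) (upsilonOf (coframeField s o)) (leftAct o) where
  action := isSmoothActionOn_leftAct
  preserves_omega g y _ v := by simp only [omegaOf_apply, coframeField_leftAct]
  preserves_upsilon g y _ v := by simp only [upsilonOf_apply, coframeField_leftAct]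
  faithful g h := by
    have hone := chart_symm_one_mem_domain o
    exact (leftAct_eq_self_iff hone g).1 (h _ hone)
  closed g _ hmaps hlim := exists_leftAct_eqOn_of_tendsto g hmaps fun _ hz => hlim.tendsto_at hz
  principal y hy z hz := ⟨1, fun g => by
    rw [one_mul, inv_one, mul_one, leftAct_eq_self_iff hy, leftAct_eq_self_iff hz]⟩
  cohomogeneity_two y hy := finrank_orbitTangent_leftAct hy
  coisotropic y hy v hv :=
    omegaSq_omegaOf_eq_zero fun i => ((isO2Coframe_coframeField hy).2 (v i)).1 (hv i)

end Action

end NK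

end

open NK in
theorem theorem6p1 (x : R6) (x₀ y₀ z₀ : ℝ) :
    ∃ U : Set R6, IsOpen U ∧ IsConnected U ∧ x ∈ U ∧
    ∃ (Ω : TwoForm) (Υ : ThreeFormC), IsNearlyKahlerOn U Ω Υ ∧
    ∃ (V : Type) (_ : NormedAddCommGroup V) (_ : NormedSpace ℝ V) (_ : FiniteDimensional ℝ V)
      (G : Type) (_ : Group G) (_ : TopologicalSpace G) (_ : ChartedSpace V G)
      (_ : LieGroup 𝓘(ℝ, V) ∞ G) (_ : T2Space G) (_ : ConnectedSpace G)
      (act : G → R6 → R6),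
      HasLieAlgebraSU2U1 V G ∧
      IsCohomTwoSymmetry (V := V) U Ω Υ act ∧
      IsTypeIIIWithUZero U Ω Υ (orbitTangent (V := V) act) ∧
      ∃ (f : R6 →L[ℝ] R6) (T : Torsion) (N : TypeIIIInvariants),
        IsO2Coframe Ω Υ (orbitTangent (V := V) act) x f ∧
        T.IsAt Ω Υ (orbitTangent (V := V) act) x f ∧ N.Of T ∧
        N.a₁ = x₀ ∧ N.a₂ = y₀ ∧ N.a₀ = z₀ := by
  obtain ⟨s, ζ, ha, ha₀⟩ := exists_invariants ⟨x₀, y₀⟩ z₀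
  let o : R6 := splitting.symm (1, ζ) - x
  have hchart : chart o x = (1, ζ) := by simp [o, chart_apply]
  have hx : x ∈ domain o := by simp [domain, hchart]
  have hU : IsOpen (domain o) := isOpen_domain o
  have hσ : ContDiffOn ℝ ∞ (coframeField s o) (domain o) := contDiffOn_coframeField
  have hO := fun y (hy : y ∈ domain o) => isO2Coframe_coframeField (s := s) hy
  have hR := fun y (hy : y ∈ domain o) => reducedEquations_coframeField (s := s) hy
  have hT := (hR x hx).isAt (hσ.contDiffAt (hU.mem_nhds hx))
    (Filter.eventually_of_mem (hU.mem_nhds hx) hO)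
  rw [hchart, ha, ha₀] at hT
  exact ⟨domain o, hU, isConnected_domain o, hx, omegaOf (coframeField s o),
    upsilonOf (coframeField s o),
    isNearlyKahlerOn_of_reducedEquations hU hσ (fun _ => coframeField_bijective)
      fun y hy => ⟨_, _, _, _, hR y hy⟩,
    Quaternion ℝ, inferInstance, inferInstance, inferInstance, (Quaternion ℝ)ˣ, inferInstance,
    inferInstance, inferInstance, inferInstance, inferInstance, connectedSpace_quaternion_units,
    leftAct o, hasLieAlgebraSU2U1_quaternion_units, isCohomTwoSymmetry_leftAct,
    isTypeIIIWithUZero_of_reducedEquations hU hσ hO fun y hy => ⟨_, _, _, _, hR y hy⟩,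
    coframeField s o x, _, _, hO x hx, hT, reducedInvariants_of _ _ _,
    reducedInvariants_a₁ _ _ _, reducedInvariants_a₂ _ _ _, reducedInvariants_a₀ _ _ _⟩
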